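/- Let $\tau>0$, $\delta\in(0,1)$ and $0<\Theta<\frac{\pi}{4}$. Let $$D_\Theta=\{x+iy\in\mathbb C:\ 0<x<\pi,\ |y|<\tan\Theta\,\min(x,\pi-x)\},\qquad \rho_\delta(s)=|s|^\delta|\pi-s|^\delta,$$ and let $A^{1,2}_\delta(D_\Theta)$ be the space of holomorphic functions $f$ on $D_\Theta$ with $$\|f\|^2_{A^{1,2}_\delta(D_\Theta)}=\int_{D_\Theta}\bigl(|f(s)|^2+|f'(s)|^2\bigr)\rho_\delta(s)\,dA(s)<\infty ,$$ where $dA$ is the two-dimensional Lebesgue measure; such an $f$ is identified with its trace on $(0,\pi)$. For $u=(u_0,u_\pi)\in L^2([0,\tau];\mathbb C^2)$ consider the boundary value problem $$\partial_t z=\partial_x^2 z\ \text{ on }(0,\tau)\times(0,\pi),\qquad \partial_xz(t,0)=u_0(t),\quad \partial_xz(t,\pi)=u_\pi(t),\qquad z(0,\cdot)=0 .$$ A solution is a function $z\in C([0,\tau];L^2(0,\pi))$ with $z(0)=0$ such that, for all $t\in[0,\tau]$ and all $\varphi\in W^{2,2}(0,\pi)$ with $\varphi'(0)=\varphi'(\pi)=0$,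 $$\int_0^\pi z(t,x)\varphi(x)\,dx=\int_0^t\!\int_0^\pi z(s,x)\varphi''(x)\,dx\,ds+\int_0^t\bigl(u_\pi(s)\varphi(\pi)-u_0(s)\varphi(0)\bigr)ds .$$ For each $u$ there is exactly one solution $z$. The function $\Phi^N_\tau u:=z(\tau,\cdot)$ is the trace on $(0,\pi)$ of an element of $A^{1,2}_\delta(D_\Theta)$, still denoted by $\Phi_\tau^Nu$, and the Neumann input map $\Phi^N_\tau$ is a Hilbert–Schmidt operator from $L^2([0,\tau];\mathbb C^2)$ to $A^{1,2}_\delta(D_\Theta)$. Moreover, for every $\gamma\in[0,\frac{\delta}{4})$: 1. For every $\omega>0$ the functions $e_n(t)=(\tau-t)^{-\gamma}e^{in\omega t}$ $(n\in\mathbb Z,\ t\in[0,\tau))$ satisfy $$\sum_{n\in\mathbb Z}\left\|\Phi^N_\tau\begin{bmatrix}e_n\\0\end{bmatrix}\right\|^2_{A^{1,2}_\delta(D_\Theta)}+\sum_{n\in\mathbb Z}\left\|\Phi^N_\tau\begin{bmatrix}0\\e_n\end{bmatrix}\right\|^2_{A^{1,2}_\delta(D_\Theta)}<\infty .$$ 2.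 There is a Hilbert–Schmidt operator $L$ (the weighted Neumann input map) from $L^2([0,\tau];\mathbb C^2)$ to $A^{1,2}_\delta(D_\Theta)$ such that $Lu=\Phi^N_\tau(u_\gamma)$, where $u_\gamma(\sigma)=(\tau-\sigma)^{-\gamma}u(\sigma)$, for every $u\in L^2([0,\tau];\mathbb C^2)$ with $u_\gamma\in L^2([0,\tau];\mathbb C^2)$, in particular for every bounded $u$. -/

import Mathlib

open MeasureTheory Set

noncomputable section

/-! ## The rhombus and the weighted Bergman–Sobolev space -/

/-- The open rhombus `D_Θ` with vertices `0`, `π/2 (1 ± i tan Θ)` and `π`. -/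
def rhombus (Θ : ℝ) : Set ℂ :=
  {s : ℂ | 0 < s.re ∧ s.re < Real.pi ∧ |s.im| < Real.tan Θ * min s.re (Real.pi - s.re)}

theorem isOpen_rhombus (Θ : ℝ) : IsOpen (rhombus Θ) := by
  have h1 : IsOpen {s : ℂ | 0 < s.re} := isOpen_lt (by fun_prop) (by fun_prop)
  have h2 : IsOpen {s : ℂ | s.re < Real.pi} := isOpen_lt (by fun_prop) (by fun_prop)
  have h3 : IsOpen {s : ℂ | |s.im| < Real.tan Θ * min s.re (Real.pi - s.re)} :=
    isOpen_lt (by fun_prop) (by fun_prop)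
  exact h1.inter (h2.inter h3)

/-- The measure `ρ_δ dA` on `D_Θ`, where `ρ_δ(s) = |s|^δ |π - s|^δ` and `dA` is the
two-dimensional Lebesgue measure. -/
def bergmanMeasure (δ Θ : ℝ) : Measure ℂ :=
  ((volume : Measure ℂ).withDensity
    (fun s => ENNReal.ofReal (‖s‖ ^ δ * ‖(Real.pi : ℂ) - s‖ ^ δ))).restrict (rhombus Θ)

/-- `L²_δ(D_Θ) × L²_δ(D_Θ)` with the Hilbert norm `‖(f, g)‖² = ‖f‖² + ‖g‖²`. -/
abbrev BergmanPair (δ Θ : ℝ) : Type :=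
  WithLp 2 (Lp ℂ 2 (bergmanMeasure δ Θ) × Lp ℂ 2 (bergmanMeasure δ Θ))

/-- `F` is holomorphic on `D_Θ` and `p` is the pair of classes `([F], [F'])`; in particular
`F` and `F'` both belong to `L²_δ(D_Θ)`. -/
def IsHolomorphicRep {δ Θ : ℝ} (p : BergmanPair δ Θ) (F : ℂ → ℂ) : Prop :=
  DifferentiableOn ℂ F (rhombus Θ) ∧
    (∀ᵐ s ∂(bergmanMeasure δ Θ), p.fst s = F s) ∧
    (∀ᵐ s ∂(bergmanMeasure δ Θ), p.snd s = deriv F s)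

/-- The weighted Bergman–Sobolev space `A^{1,2}_δ(D_Θ)` of the holomorphic functions `F` on `D_Θ`
with `F, F' ∈ L²_δ(D_Θ)`. The function `F` is stored as the pair of classes `([F], [F'])`, so that
the inherited inner product is the one of `A^{1,2}_δ(D_Θ)`:
`‖F‖² = ∫_{D_Θ} (|F|² + |F'|²) ρ_δ dA`. -/
def BergmanSobolev (δ Θ : ℝ) : Submodule ℂ (BergmanPair δ Θ) where
  carrier := {p | ∃ F : ℂ → ℂ, IsHolomorphicRep p F}
  zero_mem' := by
    refine ⟨fun _ => 0, differentiableOn_const _, ?_, ?_⟩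
    · filter_upwards [Lp.coeFn_zero ℂ 2 (bergmanMeasure δ Θ)] with s hs
      simpa using hs
    · filter_upwards [Lp.coeFn_zero ℂ 2 (bergmanMeasure δ Θ)] with s hs
      simpa using hs
  add_mem' := by
    rintro p q ⟨F, hF, hF1, hF2⟩ ⟨G, hG, hG1, hG2⟩
    refine ⟨fun s => F s + G s, hF.add hG, ?_, ?_⟩
    · filter_upwards [Lp.coeFn_add p.fst q.fst, hF1, hG1] with s hs h1 h2
      rw [WithLp.add_fst, hs, Pi.add_apply, h1, h2]
    · filter_upwards [Lp.coeFn_add p.snd q.snd, hF2, hG2,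
        ae_restrict_mem (isOpen_rhombus Θ).measurableSet] with s hs h1 h2 hmem
      have hn := (isOpen_rhombus Θ).mem_nhds hmem
      rw [WithLp.add_snd, hs, Pi.add_apply, h1, h2]
      exact (deriv_fun_add (hF.differentiableAt hn) (hG.differentiableAt hn)).symm
  smul_mem' := by
    rintro c p ⟨F, hF, hF1, hF2⟩
    refine ⟨fun s => c * F s, hF.const_mul c, ?_, ?_⟩
    · filter_upwards [Lp.coeFn_smul c p.fst, hF1] with s hs h1
      rw [WithLp.smul_fst, hs, Pi.smul_apply, h1, smul_eq_mul]
    · filter_upwards [Lp.coeFn_smul c p.snd, hF2,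
        ae_restrict_mem (isOpen_rhombus Θ).measurableSet] with s hs h1 hmem
      have hn := (isOpen_rhombus Θ).mem_nhds hmem
      rw [WithLp.smul_snd, hs, Pi.smul_apply, h1, smul_eq_mul]
      exact (deriv_const_mul c (hF.differentiableAt hn)).symm

/-! ## The heat equation on `(0, π)` with Neumann boundary inputs -/

/-- The state space `L²(0, π)`. -/
abbrev StateSpace : Type :=
  Lp ℂ 2 ((volume : Measure ℝ).restrict (Ioo 0 Real.pi))

/-- The input space `L²([0, τ]; ℂ²)`; component `0` is the input `u₀` at `x = 0` and component
`1` is the input `u_π` at `x = π`. -/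
abbrev InputSpace (τ : ℝ) : Type :=
  Lp (EuclideanSpace ℂ (Fin 2)) 2 ((volume : Measure ℝ).restrict (Icc 0 τ))

/-- `φ` belongs to the domain `{φ ∈ W^{2,2}(0, π) | φ'(0) = φ'(π) = 0}` of the Neumann Laplacian,
with `φ' = φ₁` and `φ'' = φ₂`: on the interval, `W^{2,2}(0, π)` consists of the continuously
differentiable functions on `[0, π]` whose derivative is an indefinite integral of a function
in `L²(0, π)`. -/
structure IsNeumannDomain (φ φ₁ φ₂ : ℝ → ℂ) : Prop where
  memLp : MemLp φ₂ 2 ((volume : Measure ℝ).restrict (Ioo 0 Real.pi))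
  deriv_eq : ∀ x ∈ Icc 0 Real.pi, φ₁ x = φ₁ 0 + ∫ y in (0 : ℝ)..x, φ₂ y
  eq : ∀ x ∈ Icc 0 Real.pi, φ x = φ 0 + ∫ y in (0 : ℝ)..x, φ₁ y
  deriv_zero : φ₁ 0 = 0
  deriv_pi : φ₁ Real.pi = 0

/-- The function `z ∈ C([0, τ]; L²(0, π))` is the solution of
`∂z/∂t = ∂²z/∂x²` on `(0, π)`, `∂z/∂x(t, 0) = u₀(t)`, `∂z/∂x(t, π) = u_π(t)`, `z(0, ·) = 0`.
The equation `z(t) = ∫₀ᵗ (A z(s) + B u(s)) ds` is required in the dual `X₋₁` of the domain of the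
(self-adjoint) Neumann Laplacian `A`, that is, after testing with each element of this domain; the
boundary terms are those of two integrations by parts,
`∫₀^π z'' φ dx = u_π φ(π) - u₀ φ(0) + ∫₀^π z φ'' dx`. -/
structure IsNeumannSolution (τ : ℝ) (u : InputSpace τ) (z : ℝ → StateSpace) : Prop where
  continuousOn : ContinuousOn z (Icc 0 τ)
  initial : z 0 = 0
  equation : ∀ φ φ₁ φ₂ : ℝ → ℂ, IsNeumannDomain φ φ₁ φ₂ → ∀ t ∈ Icc 0 τ,
    ∫ x in Ioo 0 Real.pi, z t x * φ x =
      (∫ s in (0 : ℝ)..t, ∫ x in Ioo 0 Real.pi, z s x * φ₂ x) +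
        ∫ s in (0 : ℝ)..t, (u s 1 * φ Real.pi - u s 0 * φ 0)

/-- The trace on `(0, π)` of the element `f` of `A^{1,2}_δ(D_Θ)` is the state `x ∈ L²(0, π)`,
i.e. `f` is the holomorphic extension of `x` to `D_Θ`. -/
def HasTrace {δ Θ : ℝ} (f : BergmanSobolev δ Θ) (x : StateSpace) : Prop :=
  ∃ F : ℂ → ℂ, IsHolomorphicRep (f : BergmanPair δ Θ) F ∧
    ∀ᵐ t : ℝ ∂((volume : Measure ℝ).restrict (Ioo 0 Real.pi)), x t = F (t : ℂ)

/-! ## Hilbert–Schmidt operators -/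

/-- A bounded operator is Hilbert–Schmidt if the squares of the norms of the images of the
elements of each orthonormal basis are summable. -/
def IsHilbertSchmidt {H : Type*} {K : Type*} [NormedAddCommGroup H] [InnerProductSpace ℂ H]
    [NormedAddCommGroup K] [InnerProductSpace ℂ K] (T : H →L[ℂ] K) : Prop :=
  ∀ (s : Set H) (b : HilbertBasis s ℂ H), Summable fun i : s => ‖T (b i)‖ ^ 2

end

/-! The solution is the mild one, z(τ, x) = ∫₀^τ (K(τ - σ, π - x) u_π(σ) - K(τ - σ, x) u₀(σ)) dσ,
where K is the Neumann heat kernel with source at 0. K is a theta function, entire in x, so the same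
integral with x replaced by s ∈ D_Θ is the holomorphic extension.

Size of the kernel. Poisson summation writes K as a sum of Gaussians centred at 2πn. Because tan Θ <
1, Re (s - 2πn)² stays comparable to the squared distance to the sources. Trading Gaussian decay for
a power gives, for every a > 0, |K(t, s)| ≤ C t^(a - 1/2) |s|^(-2a), and Cauchy's estimate costs one
more power of |s| for the derivative (`exists_norm_heatKernel_le`,
`exists_norm_heatKernelDeriv_le`). With the extra weight (τ - σ)^(-γ), the time factor is in L² when
a > γ, while |s|^(-2a - 1) is in L² for ρ_δ dA when a < δ/4. Both hold for some a because γ < δ/4.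

Hilbert–Schmidt property. Evaluation of the output and of its derivative at s are therefore
functionals of norm at most B(s), with B in L²_δ. Summing |ψ_s(b_i)|² over a Bessel family with
bound M gives at most M B(s)², and integration over D_Θ gives summability
(`exists_bergman_operator`, `exists_weightedInputMap`). Orthonormal bases have M = 1. The
exponentials on [0, τ] are a Bessel family too, and the weight in e_n is carried by the weighted
operator.

The weak equation. Cosines are complete on (0, π). Testing with cos(mx) reduces the problem to
scalar linear equations, which yield uniqueness (`IsNeumannSolution.eqOn`) and, through Duhamel's
formula, existence (`exists_isNeumannSolution`). The remaining test functions are recovered from the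
cosines by `weak_equation_of_cos`. -/

noncomputable section

/-! ## The Neumann heat kernel with source at the origin -/

/-- The Neumann heat kernel `π⁻¹ ∑ₙ exp (-n² t + i n s)` on `(0, π)` with source at `0`, as an
entire function of `s`; it vanishes for `t ≤ 0`. -/
def heatKernel (t : ℝ) (s : ℂ) : ℂ :=
  (Real.pi : ℂ)⁻¹ * jacobiTheta₂ (s / (2 * Real.pi)) (Complex.I * t / Real.pi)

/-- The derivative of `heatKernel t`. -/
def heatKernelDeriv (t : ℝ) (s : ℂ) : ℂ :=
  (Real.pi : ℂ)⁻¹ * (jacobiTheta₂' (s / (2 * Real.pi)) (Complex.I * t / Real.pi) *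
    (1 / (2 * Real.pi)))

lemma im_thetaTime (t : ℝ) : (Complex.I * t / Real.pi).im = t / Real.pi := by
  have : Complex.I * t / Real.pi = ((t / Real.pi : ℝ) : ℂ) * Complex.I := by
    push_cast; ring
  rw [this]; simp

lemma im_thetaTime_pos {t : ℝ} (ht : 0 < t) : 0 < (Complex.I * t / Real.pi).im := by
  rw [im_thetaTime]; exact div_pos ht Real.pi_pos

lemma heatKernel_of_nonpos {t : ℝ} (ht : t ≤ 0) (s : ℂ) : heatKernel t s = 0 := by
  rw [heatKernel, jacobiTheta₂_undef, mul_zero]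
  rw [im_thetaTime]; exact div_nonpos_of_nonpos_of_nonneg ht Real.pi_pos.le

lemma heatKernelDeriv_of_nonpos {t : ℝ} (ht : t ≤ 0) (s : ℂ) : heatKernelDeriv t s = 0 := by
  rw [heatKernelDeriv, jacobiTheta₂'_undef, zero_mul, mul_zero]
  rw [im_thetaTime]; exact div_nonpos_of_nonpos_of_nonneg ht Real.pi_pos.le

lemma hasSum_heatKernel {t : ℝ} (ht : 0 < t) (s : ℂ) :
    HasSum (fun n : ℤ => (Real.pi : ℂ)⁻¹ * Complex.exp (-(n : ℂ) ^ 2 * t + Complex.I * n * s))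
      (heatKernel t s) := by
  refine HasSum.mul_left _ ?_
  refine (hasSum_jacobiTheta₂_term (s / (2 * Real.pi)) (im_thetaTime_pos ht)).congr_fun fun n => ?_
  have hpi : (Real.pi : ℂ) ≠ 0 := by exact_mod_cast Real.pi_ne_zero
  have hI : Complex.I ^ 2 = -1 := Complex.I_sq
  rw [jacobiTheta₂_term]
  congr 1
  field_simp
  linear_combination (-(n : ℂ) ^ 2 * t) * hI

lemma hasDerivAt_heatKernel (t : ℝ) (s : ℂ) :
    HasDerivAt (heatKernel t) (heatKernelDeriv t s) s := by
  rcases le_or_gt t 0 with ht | ht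
  · rw [heatKernelDeriv_of_nonpos ht]
    have : heatKernel t = fun _ => 0 := funext fun s => heatKernel_of_nonpos ht s
    rw [this]; exact hasDerivAt_const _ _
  · have h := hasDerivAt_jacobiTheta₂_fst (s / (2 * Real.pi)) (im_thetaTime_pos ht)
    exact ((h.comp s ((hasDerivAt_id s).div_const (2 * (Real.pi : ℂ)))).const_mul
      (Real.pi : ℂ)⁻¹)

lemma continuous_thetaArg : Continuous fun p : ℝ × ℂ =>
    (p.2 / (2 * Real.pi), Complex.I * p.1 / (Real.pi : ℂ)) := by
  fun_prop

lemma continuousAt_heatKernel {t : ℝ} (ht : 0 < t) (s : ℂ) :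
    ContinuousAt (fun p : ℝ × ℂ => heatKernel p.1 p.2) (t, s) := by
  have h1 := continuousAt_jacobiTheta₂ (s / (2 * Real.pi)) (im_thetaTime_pos ht)
  have h2 := ContinuousAt.comp_of_eq h1 (continuous_thetaArg.continuousAt (x := (t, s))) rfl
  exact continuousAt_const.mul h2

lemma continuousAt_heatKernelDeriv {t : ℝ} (ht : 0 < t) (s : ℂ) :
    ContinuousAt (fun p : ℝ × ℂ => heatKernelDeriv p.1 p.2) (t, s) := by
  have h1 := continuousAt_jacobiTheta₂' (s / (2 * Real.pi)) (im_thetaTime_pos ht)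
  have h2 := ContinuousAt.comp_of_eq h1 (continuous_thetaArg.continuousAt (x := (t, s))) rfl
  exact continuousAt_const.mul (h2.mul continuousAt_const)

/-- Theta functions are continuous only over the upper half-plane, that is for t > 0. The default
value zero at other times allows gluing along t = 0. -/
lemma measurable_of_continuousAt_of_zero {f : ℝ × ℂ → ℂ} (h0 : ∀ t ≤ 0, ∀ s, f (t, s) = 0)
    (hc : ∀ t > 0, ∀ s, ContinuousAt f (t, s)) : Measurable f := by
  have hU : MeasurableSet {p : ℝ × ℂ | 0 < p.1} := measurableSet_lt measurable_const measurable_fst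
  refine measurable_of_restrict_of_restrict_compl hU ?_ ?_
  · have : ContinuousOn f {p : ℝ × ℂ | 0 < p.1} := fun p hp => (hc p.1 hp p.2).continuousWithinAt
    exact (continuousOn_iff_continuous_domRestrict.1 this).measurable
  · have : ({p : ℝ × ℂ | 0 < p.1}ᶜ.domRestrict f) = fun _ => 0 := by
      ext ⟨⟨t, s⟩, ht⟩
      exact h0 t (not_lt.1 ht) s
    rw [this]; exact measurable_const

lemma measurable_heatKernel : Measurable fun p : ℝ × ℂ => heatKernel p.1 p.2 :=
  measurable_of_continuousAt_of_zero (fun _ ht s => heatKernel_of_nonpos ht s)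
    fun _ ht s => continuousAt_heatKernel ht s

lemma measurable_heatKernelDeriv : Measurable fun p : ℝ × ℂ => heatKernelDeriv p.1 p.2 :=
  measurable_of_continuousAt_of_zero (fun _ ht s => heatKernelDeriv_of_nonpos ht s)
    fun _ ht s => continuousAt_heatKernelDeriv ht s

/-- The expansion of the kernel in Gaussians centred at the reflected sources `2 π n`. -/
lemma hasSum_heatKernel_images {t : ℝ} (ht : 0 < t) (s : ℂ) :
    HasSum (fun n : ℤ => (Real.pi : ℂ)⁻¹ * (1 / ((t / Real.pi : ℝ) : ℂ) ^ (1 / 2 : ℂ) *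
      Complex.exp (-(s - 2 * Real.pi * n) ^ 2 / (4 * t)))) (heatKernel t s) := by
  have hpi : (Real.pi : ℂ) ≠ 0 := by exact_mod_cast Real.pi_ne_zero
  have ht' : (t : ℂ) ≠ 0 := by exact_mod_cast ht.ne'
  have hI : Complex.I ^ 2 = -1 := Complex.I_sq
  -- The functional equation is Poisson summation. Its Gaussian prefactor and the n-th theta term
  -- merge into one Gaussian by completing the square.
  rw [heatKernel, jacobiTheta₂_functional_equation]
  refine HasSum.mul_left _ ?_
  have him : 0 < (-1 / (Complex.I * t / Real.pi) : ℂ).im := by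
    have : -1 / (Complex.I * t / Real.pi) = ((Real.pi / t : ℝ) : ℂ) * Complex.I := by
      push_cast; field_simp; linear_combination -hI
    rw [this]; simp; positivity
  convert (hasSum_jacobiTheta₂_term (s / (2 * Real.pi) / (Complex.I * t / Real.pi)) him).mul_left
    (1 / (-Complex.I * (Complex.I * t / Real.pi)) ^ (1 / 2 : ℂ) *
      Complex.exp (-Real.pi * Complex.I * (s / (2 * Real.pi)) ^ 2 / (Complex.I * t / Real.pi)))
      using 1
  ext n
  have h1 : -Complex.I * (Complex.I * t / Real.pi) = ((t / Real.pi : ℝ) : ℂ) := by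
    push_cast; linear_combination (-(t : ℂ) / Real.pi) * hI
  rw [h1, jacobiTheta₂_term, mul_assoc (1 / ((t / Real.pi : ℝ) : ℂ) ^ (1 / 2 : ℂ)), ← Complex.exp_add]
  congr 2
  field_simp
  ring

/-! ## Pointwise bounds for the heat kernel -/

/-- Raise `y / a ≤ exp (y / a)` to the power `a`. The free exponent `a` later splits Gaussian decay
between time and space. -/
lemma Real.exp_neg_le_rpow_neg {a y : ℝ} (ha : 0 < a) (hy : 0 < y) :
    Real.exp (-y) ≤ a ^ a * y ^ (-a) := by
  have h1 : y / a ≤ Real.exp (y / a) := by linarith [Real.add_one_le_exp (y / a)]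
  have h2 : (y / a) ^ a ≤ Real.exp y := by
    calc (y / a) ^ a ≤ (Real.exp (y / a)) ^ a := by gcongr
      _ = Real.exp y := by rw [← Real.exp_mul]; congr 1; field_simp
  rw [Real.div_rpow hy.le ha.le, div_le_iff₀ (by positivity)] at h2
  rw [Real.exp_neg, Real.rpow_neg hy.le, ← div_eq_mul_inv, inv_eq_one_div,
    div_le_div_iff₀ (Real.exp_pos _) (by positivity)]
  linarith

/-- Up to the factor π these are the norms of the terms of the kernel series at s = 0. -/
lemma summable_exp_neg_mul_int_sq {b : ℝ} (hb : 0 < b) :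
    Summable fun n : ℤ => Real.exp (-b * (n : ℝ) ^ 2) := by
  have h := (hasSum_heatKernel hb 0).summable.norm.mul_left Real.pi
  refine h.congr fun n => ?_
  have : (-(n : ℂ) ^ 2 * b + Complex.I * n * 0) = ((-b * (n : ℝ) ^ 2 : ℝ) : ℂ) := by
    push_cast; ring
  rw [this, norm_mul, norm_inv, ← Complex.ofReal_exp, Complex.norm_real, Complex.norm_real,
    Real.norm_of_nonneg Real.pi_pos.le, Real.norm_of_nonneg (Real.exp_pos _).le,
    mul_inv_cancel_left₀ Real.pi_ne_zero]

/-- The sources 0 and 2π lie at distance at least d from x, and moving away from them by one index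
adds 2π ≥ 1. So J is n² for n ≤ 0 and (n - 1)² for n ≥ 1; n²/2 - 1 is below both, the second because
(n - 2)² ≥ 0. -/
lemma exists_le_sq_sub_image {x d : ℝ} (hd : 0 ≤ d) (h1 : d ≤ x) (h2 : d ≤ 2 * Real.pi - x)
    (n : ℤ) : ∃ J : ℝ, 0 ≤ J ∧ (n : ℝ) ^ 2 / 2 - 1 ≤ J ∧
      d ^ 2 + J ≤ (x - 2 * Real.pi * n) ^ 2 := by
  have hpi := Real.pi_gt_three
  rcases le_or_gt n 0 with hn | hn
  · have hn' : (n : ℝ) ≤ 0 := by exact_mod_cast hn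
    refine ⟨(n : ℝ) ^ 2, sq_nonneg _, by nlinarith [sq_nonneg (n : ℝ)], ?_⟩
    have : d - n ≤ x - 2 * Real.pi * n := by nlinarith
    calc d ^ 2 + (n : ℝ) ^ 2 ≤ (d - n) ^ 2 := by nlinarith
      _ ≤ _ := by gcongr; linarith
  · have hn' : (1 : ℝ) ≤ n := by exact_mod_cast hn
    refine ⟨((n : ℝ) - 1) ^ 2, sq_nonneg _, by nlinarith [sq_nonneg ((n : ℝ) - 2)], ?_⟩
    have : d + (n - 1) ≤ 2 * Real.pi * n - x := by nlinarith
    calc d ^ 2 + ((n : ℝ) - 1) ^ 2 ≤ (d + (n - 1)) ^ 2 := by nlinarith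
      _ ≤ (2 * Real.pi * n - x) ^ 2 := by gcongr
      _ = _ := by ring

/-- Off the real axis, but inside a double sector of aperture less than `π / 4`, the heat kernel is
bounded by powers of the time and of the distance to the sources `0` and `2 π`. -/
lemma exists_norm_heatKernel_le {m τ a : ℝ} (hm0 : 0 ≤ m) (hm : m < 1) (hτ : 0 < τ) (ha : 0 < a) :
    ∃ C : ℝ, 0 ≤ C ∧ ∀ t : ℝ, 0 < t → t ≤ τ → ∀ x₀ : ℝ, 0 < x₀ → ∀ s : ℂ, x₀ ≤ s.re →
      x₀ ≤ 2 * Real.pi - s.re → |s.im| ≤ m * min s.re (2 * Real.pi - s.re) →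
      ‖heatKernel t s‖ ≤ C * t ^ (a - 1 / 2) * x₀ ^ (-(2 * a)) := by
  -- With X = Re s - 2πn one has X² ≥ d² + J and |Im s| ≤ m d, hence X² - (Im s)² ≥ (1 - m²)(d² +
  -- J). The Gaussian divides this by 4t.
  set c : ℝ := (1 - m ^ 2) / 4 with hc
  have hc0 : 0 < c := by rw [hc]; nlinarith
  have hsum : Summable fun n : ℤ => Real.exp (-(c * ((n : ℝ) ^ 2 / 2 - 1)) / τ) := by
    have := (summable_exp_neg_mul_int_sq (b := c / (2 * τ)) (by positivity)).mul_left
      (Real.exp (c / τ))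
    refine this.congr fun n => ?_
    rw [← Real.exp_add]
    congr 1
    field_simp
    ring
  set S : ℝ := ∑' n : ℤ, Real.exp (-(c * ((n : ℝ) ^ 2 / 2 - 1)) / τ) with hS
  have hS0 : 0 ≤ S := tsum_nonneg fun n => (Real.exp_pos _).le
  have hpi := Real.pi_pos
  refine ⟨Real.pi⁻¹ * Real.pi ^ (1 / 2 : ℝ) * (a ^ a * c ^ (-a)) * S, by positivity, ?_⟩
  intro t ht htτ x₀ hx₀ s h1 h2 h3
  set d := min s.re (2 * Real.pi - s.re) with hd
  have hxd : x₀ ≤ d := le_min h1 h2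
  have hd0 : 0 < d := hx₀.trans_le hxd
  have hterm : ∀ n : ℤ, ‖(Real.pi : ℂ)⁻¹ * (1 / ((t / Real.pi : ℝ) : ℂ) ^ (1 / 2 : ℂ) *
      Complex.exp (-(s - 2 * Real.pi * n) ^ 2 / (4 * t)))‖ ≤
      Real.pi⁻¹ * (t / Real.pi) ^ (-(1 / 2) : ℝ) * Real.exp (-(c * x₀ ^ 2 / t)) *
        Real.exp (-(c * ((n : ℝ) ^ 2 / 2 - 1)) / τ) := by
    intro n
    obtain ⟨J, hJ0, hJn, hJ⟩ := exists_le_sq_sub_image hd0.le (min_le_left _ _) (min_le_right _ _) n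
    have hre : (-(s - 2 * Real.pi * n) ^ 2 / (4 * t) : ℂ).re =
        -((s.re - 2 * Real.pi * n) ^ 2 - s.im ^ 2) / (4 * t) := by
      have : (4 * t : ℂ) = ((4 * t : ℝ) : ℂ) := by push_cast; ring
      rw [this, Complex.div_ofReal_re]
      congr 1
      have : (s - 2 * Real.pi * n : ℂ) = ((s.re - 2 * Real.pi * n : ℝ) : ℂ) + s.im * Complex.I := by
        apply Complex.ext <;> simp
      rw [this]
      simp [pow_two]
    have hpow : ‖((t / Real.pi : ℝ) : ℂ) ^ (1 / 2 : ℂ)‖ = (t / Real.pi) ^ (1 / 2 : ℝ) := by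
      rw [Complex.norm_cpow_eq_rpow_re_of_pos (by positivity)]
      norm_num
    rw [norm_mul, norm_mul, norm_div, hpow, Complex.norm_exp, hre, norm_inv, Complex.norm_real,
      Real.norm_of_nonneg hpi.le, norm_one, one_div, ← Real.rpow_neg (by positivity),
      mul_assoc (Real.pi⁻¹ * _), ← Real.exp_add, ← mul_assoc Real.pi⁻¹]
    gcongr
    have hy : s.im ^ 2 ≤ m ^ 2 * d ^ 2 := by
      rw [← sq_abs s.im, ← mul_pow]; gcongr
    have hx : x₀ ^ 2 ≤ d ^ 2 := by gcongr
    -- Replacing τ by t needs a nonnegative numerator. Since n²/2 - 1 is negative for |n| ≤ 1, the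
    -- comparison passes through J ≥ 0.
    have hJ' : c * ((n : ℝ) ^ 2 / 2 - 1) / τ ≤ c * J / t := by
      calc c * ((n : ℝ) ^ 2 / 2 - 1) / τ ≤ c * J / τ := by gcongr
        _ ≤ c * J / t := by gcongr
    have key : c * x₀ ^ 2 / t + c * J / t ≤ ((s.re - 2 * Real.pi * n) ^ 2 - s.im ^ 2) / (4 * t) := by
      rw [← add_div, div_le_div_iff₀ ht (by positivity)]
      have : 4 * (c * x₀ ^ 2 + c * J) ≤ (s.re - 2 * Real.pi * n) ^ 2 - s.im ^ 2 := by
        have : 4 * c * (x₀ ^ 2 + J) ≤ 4 * c * (d ^ 2 + J) := by gcongr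
        have h4 : 4 * c = 1 - m ^ 2 := by rw [hc]; ring
        rw [h4] at this
        nlinarith [mul_nonneg (sq_nonneg m) hJ0]
      nlinarith
    rw [neg_div, neg_div]
    linarith
  have hK : ‖heatKernel t s‖ ≤ Real.pi⁻¹ * (t / Real.pi) ^ (-(1 / 2) : ℝ) *
      Real.exp (-(c * x₀ ^ 2 / t)) * S := by
    have hs := hasSum_heatKernel_images ht s
    have hb := (hsum.mul_left (Real.pi⁻¹ * (t / Real.pi) ^ (-(1 / 2) : ℝ) *
      Real.exp (-(c * x₀ ^ 2 / t))))
    rw [← hs.tsum_eq, hS, ← tsum_mul_left]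
    exact tsum_of_norm_bounded hb.hasSum hterm
  refine hK.trans ?_
  have hexp := Real.exp_neg_le_rpow_neg ha (y := c * x₀ ^ 2 / t) (by positivity)
  have e1 : (c * x₀ ^ 2 / t) ^ (-a) = c ^ (-a) * x₀ ^ (-(2 * a)) * t ^ a := by
    rw [Real.div_rpow (by positivity) ht.le, Real.mul_rpow hc0.le (by positivity),
      Real.rpow_neg ht.le, div_inv_eq_mul, ← Real.rpow_natCast x₀ 2, ← Real.rpow_mul hx₀.le]
    congr 3
    push_cast; ring
  have e2 : (t / Real.pi) ^ (-(1 / 2) : ℝ) = t ^ (-(1 / 2) : ℝ) * Real.pi ^ (1 / 2 : ℝ) := by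
    rw [Real.div_rpow ht.le hpi.le, Real.rpow_neg hpi.le, div_inv_eq_mul]
  have e3 : t ^ (a - 1 / 2) = t ^ (-(1 / 2) : ℝ) * t ^ a := by
    rw [← Real.rpow_add ht]; congr 1; ring
  calc _ ≤ Real.pi⁻¹ * (t / Real.pi) ^ (-(1 / 2) : ℝ) *
      (a ^ a * (c * x₀ ^ 2 / t) ^ (-a)) * S := by gcongr
    _ = _ := by rw [e1, e2, e3]; ring

/-- The corresponding bound for the derivative, by Cauchy's estimate. -/
lemma exists_norm_heatKernelDeriv_le {m τ a : ℝ} (hm0 : 0 ≤ m) (hm : m < 1) (hτ : 0 < τ)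
    (ha : 0 < a) :
    ∃ C : ℝ, 0 ≤ C ∧ ∀ t : ℝ, 0 < t → t ≤ τ → ∀ x₀ : ℝ, 0 < x₀ → ∀ s : ℂ, x₀ ≤ s.re →
      x₀ ≤ 2 * Real.pi - s.re → |s.im| ≤ m * min s.re (2 * Real.pi - s.re) →
      ‖heatKernelDeriv t s‖ ≤ C * t ^ (a - 1 / 2) * x₀ ^ (-(2 * a + 1)) := by
  -- Cauchy's circle has radius ε x₀ with ε = (M - m) / 2. It stays in the wider sector of slope M <
  -- 1, and as ε < 1/2 its points keep the lower bound x₀ / 2.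
  obtain ⟨M, hMm, hM1⟩ : ∃ M, m < M ∧ M < 1 := exists_between hm
  have hM0 : 0 < M := hm0.trans_lt hMm
  obtain ⟨C, hC0, hC⟩ := exists_norm_heatKernel_le hM0.le hM1 hτ ha
  set ε : ℝ := (M - m) / 2 with hε
  have hε0 : 0 < ε := by rw [hε]; linarith
  have hε1 : ε < 1 / 2 := by rw [hε]; linarith
  refine ⟨C * (1 / 2) ^ (-(2 * a)) / ε, by positivity, ?_⟩
  intro t ht htτ x₀ hx₀ s h1 h2 h3
  have hder : ‖deriv (heatKernel t) s‖ ≤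
      (C * t ^ (a - 1 / 2) * (x₀ / 2) ^ (-(2 * a))) / (ε * x₀) := by
    refine Complex.norm_deriv_le_of_forall_mem_sphere_norm_le (by positivity) ?_ ?_
    · exact (show Differentiable ℂ (heatKernel t) from
        fun s => (hasDerivAt_heatKernel t s).differentiableAt).diffContOnCl
    · intro z hz
      rw [mem_sphere_iff_norm] at hz
      have hre : |z.re - s.re| ≤ ε * x₀ := by
        rw [← hz, ← Complex.sub_re]; exact Complex.abs_re_le_norm _
      have him : |z.im - s.im| ≤ ε * x₀ := by
        rw [← hz, ← Complex.sub_im]; exact Complex.abs_im_le_norm _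
      rw [abs_le] at hre him
      have hx2 : ε * x₀ ≤ x₀ / 2 := by nlinarith
      refine hC t ht htτ (x₀ / 2) (by positivity) z (by linarith) (by linarith) ?_
      set d := min s.re (2 * Real.pi - s.re) with hd
      have hxd : x₀ ≤ d := le_min h1 h2
      have hdz : d - ε * x₀ ≤ min z.re (2 * Real.pi - z.re) := by
        have := min_le_left s.re (2 * Real.pi - s.re)
        have := min_le_right s.re (2 * Real.pi - s.re)
        refine le_min ?_ ?_ <;> linarith
      have hb : |z.im| ≤ m * d + ε * x₀ := by
        rw [abs_le] at h3 ⊢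
        constructor <;> linarith [h3.1, h3.2]
      calc |z.im| ≤ m * d + ε * x₀ := hb
        _ ≤ M * (d - ε * x₀) := by
          have : M * d - m * d = 2 * ε * d := by rw [hε]; ring
          have h5 : M * (ε * x₀) ≤ ε * x₀ := mul_le_of_le_one_left (by positivity) hM1.le
          have h6 : ε * x₀ ≤ ε * d := by gcongr
          nlinarith
        _ ≤ _ := by gcongr
  rw [(hasDerivAt_heatKernel t s).deriv] at hder
  refine hder.trans (le_of_eq ?_)
  have e1 : (x₀ / 2) ^ (-(2 * a)) = (1 / 2) ^ (-(2 * a)) * x₀ ^ (-(2 * a)) := by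
    rw [← Real.mul_rpow (by norm_num) hx₀.le]; congr 1; ring
  have e2 : x₀ ^ (-(2 * a + 1)) = x₀ ^ (-(2 * a)) / x₀ := by
    rw [← Real.rpow_sub_one hx₀.ne']; congr 1; ring
  rw [e1, e2]
  field_simp

/-! ## Operators into the Bergman–Sobolev space -/

/-- A Bessel family with bound `M`. -/
def IsBesselFamily {ι H : Type*} [NormedAddCommGroup H] [InnerProductSpace ℂ H] (b : ι → H)
    (M : ℝ) : Prop :=
  ∀ (t : Finset ι) (x : H), ∑ i ∈ t, ‖inner ℂ (b i) x‖ ^ 2 ≤ M * ‖x‖ ^ 2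

/-- Riesz representation: ℓ is the inner product with a vector of norm ‖ℓ‖, to which the Bessel
bound applies. -/
lemma IsBesselFamily.sum_sq_norm_apply_le {ι H : Type*} [NormedAddCommGroup H]
    [InnerProductSpace ℂ H] [CompleteSpace H] {b : ι → H} {M : ℝ} (hb : IsBesselFamily b M)
    (ℓ : H →L[ℂ] ℂ) (t : Finset ι) : ∑ i ∈ t, ‖ℓ (b i)‖ ^ 2 ≤ M * ‖ℓ‖ ^ 2 := by
  have h := hb t ((InnerProductSpace.toDual ℂ H).symm ℓ)
  rw [LinearIsometryEquiv.norm_map] at h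
  refine (Finset.sum_le_sum fun i _ => ?_).trans h
  rw [norm_inner_symm, InnerProductSpace.toDual_symm_apply]

lemma HilbertBasis.isBesselFamily {ι H : Type*} [NormedAddCommGroup H] [InnerProductSpace ℂ H]
    (b : HilbertBasis ι ℂ H) : IsBesselFamily b 1 := fun t x => by
  rw [one_mul]; exact b.orthonormal.sum_inner_products_le x

lemma MeasureTheory.MemLp.norm_toLp_sq {α E : Type*} [MeasurableSpace α] {μ : Measure α}
    [NormedAddCommGroup E] [InnerProductSpace ℂ E] {f : α → E} (hf : MemLp f 2 μ) :
    ‖hf.toLp f‖ ^ 2 = ∫ x, ‖f x‖ ^ 2 ∂μ := by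
  have h1 : (inner ℂ (hf.toLp f) (hf.toLp f) : ℂ) = ((∫ x, ‖f x‖ ^ 2 ∂μ : ℝ) : ℂ) := by
    rw [L2.inner_def, ← integral_complex_ofReal]
    refine integral_congr_ae ?_
    filter_upwards [hf.coeFn_toLp] with x hx
    rw [hx, inner_self_eq_norm_sq_to_K]
    simp
  rw [inner_self_eq_norm_sq_to_K] at h1
  exact Complex.ofReal_injective (by simpa using h1)

lemma isHolomorphicRep_mem {δ Θ : ℝ} {p : BergmanPair δ Θ} {F : ℂ → ℂ}
    (h : IsHolomorphicRep p F) : p ∈ BergmanSobolev δ Θ := ⟨F, h⟩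

lemma IsHolomorphicRep.ext {δ Θ : ℝ} {p q : BergmanSobolev δ Θ} {F G : ℂ → ℂ}
    (hp : IsHolomorphicRep (p : BergmanPair δ Θ) F) (hq : IsHolomorphicRep (q : BergmanPair δ Θ) G)
    (h : F = G) : p = q := by
  subst h
  apply Subtype.ext
  obtain ⟨-, h1, h2⟩ := hp
  obtain ⟨-, h3, h4⟩ := hq
  have e1 : (p : BergmanPair δ Θ).fst = (q : BergmanPair δ Θ).fst := by
    apply Lp.ext; filter_upwards [h1, h3] with s a b; rw [a, b]
  have e2 : (p : BergmanPair δ Θ).snd = (q : BergmanPair δ Θ).snd := by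
    apply Lp.ext; filter_upwards [h2, h4] with s a b; rw [a, b]
  exact WithLp.ofLp_injective 2 (Prod.ext e1 e2)

lemma ae_bergmanMeasure_mem (δ Θ : ℝ) : ∀ᵐ s ∂(bergmanMeasure δ Θ), s ∈ rhombus Θ :=
  ae_restrict_mem (isOpen_rhombus Θ).measurableSet

/-- A family of functionals `ψ s` that depends holomorphically on `s ∈ D_Θ`, and that is bounded
together with its derivative by a function in `L²_δ(D_Θ)`, defines an operator into the
Bergman–Sobolev space which maps Bessel families to square summable ones. -/
theorem exists_bergman_operator {H : Type} [NormedAddCommGroup H] [InnerProductSpace ℂ H]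
    [CompleteSpace H] {δ Θ : ℝ} (ψ ψ' : ℂ → H →L[ℂ] ℂ) (B : ℂ → ℝ)
    (hψ : ∀ s ∈ rhombus Θ, ∀ u, HasDerivAt (fun s => ψ s u) (ψ' s u) s)
    (hB : MemLp B 2 (bergmanMeasure δ Θ))
    (h1 : ∀ s ∈ rhombus Θ, ‖ψ s‖ ≤ B s) (h2 : ∀ s ∈ rhombus Θ, ‖ψ' s‖ ≤ B s) :
    ∃ T : H →L[ℂ] BergmanSobolev δ Θ,
      (∀ u, IsHolomorphicRep (T u : BergmanPair δ Θ) fun s => ψ s u) ∧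
      ∀ (ι : Type) (b : ι → H) (M : ℝ), 0 ≤ M → IsBesselFamily b M →
        Summable fun i => ‖T (b i)‖ ^ 2 := by
  set μ := bergmanMeasure δ Θ with hμ
  have hdiff : ∀ u, DifferentiableOn ℂ (fun s => ψ s u) (rhombus Θ) := fun u s hs =>
    (hψ s hs u).differentiableAt.differentiableWithinAt
  -- Derivatives of holomorphic functions are continuous, so measurability of ψ' in s needs no
  -- assumption.
  have hdiff' : ∀ u, ContinuousOn (fun s => ψ' s u) (rhombus Θ) := fun u => by
    refine ((hdiff u).deriv (isOpen_rhombus Θ)).continuousOn.congr fun s hs => ?_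
    exact (hψ s hs u).deriv.symm
  have hle : ∀ (χ : ℂ → H →L[ℂ] ℂ), (∀ s ∈ rhombus Θ, ‖χ s‖ ≤ B s) → ∀ u,
      ∀ᵐ s ∂μ, ‖χ s u‖ ≤ ‖u‖ * ‖B s‖ := fun χ hχ u => by
    filter_upwards [ae_bergmanMeasure_mem δ Θ] with s hs
    calc ‖χ s u‖ ≤ ‖χ s‖ * ‖u‖ := (χ s).le_opNorm u
      _ ≤ ‖B s‖ * ‖u‖ := by gcongr; exact (hχ s hs).trans (le_abs_self _)
      _ = _ := mul_comm _ _
  have hm1 : ∀ u, MemLp (fun s => ψ s u) 2 μ := fun u =>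
    hB.of_le_mul ((hdiff u).continuousOn.aestronglyMeasurable (isOpen_rhombus Θ).measurableSet)
      (hle ψ h1 u)
  have hm2 : ∀ u, MemLp (fun s => ψ' s u) 2 μ := fun u =>
    hB.of_le_mul ((hdiff' u).aestronglyMeasurable (isOpen_rhombus Θ).measurableSet)
      (hle ψ' h2 u)
  let P : H → BergmanPair δ Θ := fun u =>
    WithLp.toLp 2 ((hm1 u).toLp (fun s => ψ s u), (hm2 u).toLp (fun s => ψ' s u))
  have hrep : ∀ u, IsHolomorphicRep (P u) fun s => ψ s u := fun u => by
    refine ⟨hdiff u, (hm1 u).coeFn_toLp, ?_⟩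
    filter_upwards [(hm2 u).coeFn_toLp, ae_bergmanMeasure_mem δ Θ] with s hs hmem
    rw [(hψ s hmem u).deriv]
    exact hs
  have hsq : ∀ u, ‖P u‖ ^ 2 = ∫ s, (‖ψ s u‖ ^ 2 + ‖ψ' s u‖ ^ 2) ∂μ := fun u => by
    rw [WithLp.prod_norm_sq_eq_of_L2, integral_add]
    · congr 1
      · exact (hm1 u).norm_toLp_sq
      · exact (hm2 u).norm_toLp_sq
    · exact (hm1 u).integrable_norm_pow (by norm_num)
    · exact (hm2 u).integrable_norm_pow (by norm_num)
  have hint : ∀ u, Integrable (fun s => ‖ψ s u‖ ^ 2 + ‖ψ' s u‖ ^ 2) μ := fun u =>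
    ((hm1 u).integrable_norm_pow (by norm_num)).add ((hm2 u).integrable_norm_pow (by norm_num))
  have hBint : Integrable (fun s => 2 * B s ^ 2) μ := hB.integrable_sq.const_mul 2
  set K : ℝ := ∫ s, 2 * B s ^ 2 ∂μ with hK
  have hK0 : 0 ≤ K := integral_nonneg fun s => by positivity
  have hbd : ∀ u, ‖P u‖ ≤ Real.sqrt K * ‖u‖ := fun u => by
    refine le_of_sq_le_sq ?_ (by positivity)
    rw [hsq, mul_pow, Real.sq_sqrt hK0, hK, ← integral_mul_const]
    refine integral_mono_ae (hint u) (hBint.mul_const _) ?_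
    filter_upwards [hle ψ h1 u, hle ψ' h2 u] with s e1 e2
    have := pow_le_pow_left₀ (norm_nonneg _) e1 2
    have := pow_le_pow_left₀ (norm_nonneg _) e2 2
    simp only [mul_pow, Real.norm_eq_abs, sq_abs] at *
    linarith
  let T₀ : H →ₗ[ℂ] BergmanSobolev δ Θ :=
    { toFun := fun u => ⟨P u, isHolomorphicRep_mem (hrep u)⟩
      map_add' := fun u v => by
        apply Subtype.ext
        apply WithLp.ofLp_injective 2
        refine Prod.ext ?_ ?_
        · show (hm1 (u + v)).toLp _ = (hm1 u).toLp _ + (hm1 v).toLp _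
          rw [← MemLp.toLp_add]
          congr 1
          ext s; simp
        · show (hm2 (u + v)).toLp _ = (hm2 u).toLp _ + (hm2 v).toLp _
          rw [← MemLp.toLp_add]
          congr 1
          ext s; simp
      map_smul' := fun c u => by
        apply Subtype.ext
        apply WithLp.ofLp_injective 2
        refine Prod.ext ?_ ?_
        · show (hm1 (c • u)).toLp _ = c • (hm1 u).toLp _
          rw [← MemLp.toLp_const_smul]
          congr 1
          ext s; simp
        · show (hm2 (c • u)).toLp _ = c • (hm2 u).toLp _
          rw [← MemLp.toLp_const_smul]
          congr 1
          ext s; simp }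
  refine ⟨T₀.mkContinuous (Real.sqrt K) hbd, hrep, fun ι b M hM hb => ?_⟩
  -- Finite sums commute with the integral over s. For fixed s the Bessel bound is applied to the
  -- two functionals ψ s and ψ' s, whence the factor 2.
  refine summable_of_sum_le (c := ∫ s, 2 * (M * B s ^ 2) ∂μ) (fun i => by positivity) fun t => ?_
  have e : ∀ i, ‖T₀.mkContinuous (Real.sqrt K) hbd (b i)‖ ^ 2 =
      ∫ s, (‖ψ s (b i)‖ ^ 2 + ‖ψ' s (b i)‖ ^ 2) ∂μ := fun i => hsq (b i)
  simp_rw [e]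
  rw [← integral_finsetSum _ fun i _ => hint (b i)]
  have hMB : Integrable (fun s => 2 * (M * B s ^ 2)) μ :=
    (hB.integrable_sq.const_mul M).const_mul 2
  refine integral_mono_ae (integrable_finsetSum _ fun i _ => hint (b i)) hMB ?_
  filter_upwards [ae_bergmanMeasure_mem δ Θ] with s hs
  rw [Finset.sum_add_distrib]
  have k1 : M * ‖ψ s‖ ^ 2 ≤ M * B s ^ 2 := by gcongr; exact h1 s hs
  have k2 : M * ‖ψ' s‖ ^ 2 ≤ M * B s ^ 2 := by gcongr; exact h2 s hs
  linarith [hb.sum_sq_norm_apply_le (ψ s) t, hb.sum_sq_norm_apply_le (ψ' s) t]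

/-! ## The boundary kernel -/

/-- The kernel of the input map: the responses to the Neumann data at `0` and at `π`. -/
def boundaryKernel (t : ℝ) (s : ℂ) : EuclideanSpace ℂ (Fin 2) :=
  !₂[-heatKernel t s, heatKernel t (Real.pi - s)]

/-- The derivative of `boundaryKernel t`. -/
def boundaryKernelDeriv (t : ℝ) (s : ℂ) : EuclideanSpace ℂ (Fin 2) :=
  !₂[-heatKernelDeriv t s, -heatKernelDeriv t (Real.pi - s)]

/-- The bilinear pairing on `ℂ²`. -/
def dotPair (x y : EuclideanSpace ℂ (Fin 2)) : ℂ := x 0 * y 0 + x 1 * y 1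

/-- The pairing is bilinear, so that it is holomorphic in the kernel, whereas the inner product is
conjugate-linear in its first slot; hence the conjugates. -/
lemma dotPair_eq_inner (x y : EuclideanSpace ℂ (Fin 2)) :
    dotPair x y = inner ℂ (!₂[star (x 0), star (x 1)] : EuclideanSpace ℂ (Fin 2)) y := by
  simp [dotPair, PiLp.inner_apply, Fin.sum_univ_two, mul_comm]

lemma norm_conj_pair (x : EuclideanSpace ℂ (Fin 2)) :
    ‖(!₂[star (x 0), star (x 1)] : EuclideanSpace ℂ (Fin 2))‖ = ‖x‖ := by
  simp [EuclideanSpace.norm_eq, Fin.sum_univ_two]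

lemma norm_dotPair_le (x y : EuclideanSpace ℂ (Fin 2)) : ‖dotPair x y‖ ≤ ‖x‖ * ‖y‖ := by
  rw [dotPair_eq_inner, ← norm_conj_pair x]; exact norm_inner_le_norm _ _

lemma norm_le_add_norm (x : EuclideanSpace ℂ (Fin 2)) : ‖x‖ ≤ ‖x 0‖ + ‖x 1‖ := by
  rw [EuclideanSpace.norm_eq, Fin.sum_univ_two]
  exact Real.sqrt_le_iff.2 ⟨by positivity, by nlinarith [norm_nonneg (x 0), norm_nonneg (x 1)]⟩

lemma hasDerivAt_dotPair_boundaryKernel (t : ℝ) (s : ℂ) (y : EuclideanSpace ℂ (Fin 2)) :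
    HasDerivAt (fun s => dotPair (boundaryKernel t s) y) (dotPair (boundaryKernelDeriv t s) y) s := by
  have h1 := (hasDerivAt_heatKernel t s).neg.mul_const (y 0)
  have h2 := HasDerivAt.comp_const_sub (Real.pi : ℂ) s (hasDerivAt_heatKernel t (Real.pi - s))
  exact h1.add (h2.mul_const (y 1))

lemma measurable_boundaryKernel : Measurable fun p : ℝ × ℂ => boundaryKernel p.1 p.2 := by
  have h : Measurable fun p : ℝ × ℂ => heatKernel p.1 (Real.pi - p.2) :=
    measurable_heatKernel.comp (g := fun p : ℝ × ℂ => heatKernel p.1 p.2)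
      (f := fun p : ℝ × ℂ => (p.1, (Real.pi : ℂ) - p.2)) (by fun_prop)
  refine (WithLp.measurable_toLp 2 (Fin 2 → ℂ)).comp (measurable_pi_iff.2 ?_)
  exact Fin.forall_fin_two.2 ⟨measurable_heatKernel.neg, h⟩

lemma measurable_boundaryKernelDeriv : Measurable fun p : ℝ × ℂ => boundaryKernelDeriv p.1 p.2 := by
  have h : Measurable fun p : ℝ × ℂ => heatKernelDeriv p.1 (Real.pi - p.2) :=
    measurable_heatKernelDeriv.comp (g := fun p : ℝ × ℂ => heatKernelDeriv p.1 p.2)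
      (f := fun p : ℝ × ℂ => (p.1, (Real.pi : ℂ) - p.2)) (by fun_prop)
  refine (WithLp.measurable_toLp 2 (Fin 2 → ℂ)).comp (measurable_pi_iff.2 ?_)
  exact Fin.forall_fin_two.2 ⟨measurable_heatKernelDeriv.neg, h.neg⟩

lemma boundaryKernel_of_nonpos {t : ℝ} (ht : t ≤ 0) (s : ℂ) : boundaryKernel t s = 0 := by
  ext i; fin_cases i <;> simp [boundaryKernel, heatKernel_of_nonpos ht]

/-- The two components are related by the reflection s ↦ π - s, which preserves the sector
condition. The kernel bounds are used with x₀ = Re s and x₀ = π - Re s; the source 2π is farther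
away in both cases. -/
lemma exists_norm_boundaryKernel_le {m τ a : ℝ} (hm0 : 0 ≤ m) (hm : m < 1) (hτ : 0 < τ)
    (ha : 0 < a) :
    ∃ C : ℝ, 0 ≤ C ∧ ∀ t : ℝ, 0 < t → t ≤ τ → ∀ s : ℂ, 0 < s.re → s.re < Real.pi →
      |s.im| ≤ m * min s.re (Real.pi - s.re) →
      ‖boundaryKernel t s‖ ≤
          C * t ^ (a - 1 / 2) * (s.re ^ (-(2 * a)) + (Real.pi - s.re) ^ (-(2 * a))) ∧
        ‖boundaryKernelDeriv t s‖ ≤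
          C * t ^ (a - 1 / 2) * (s.re ^ (-(2 * a + 1)) + (Real.pi - s.re) ^ (-(2 * a + 1))) := by
  obtain ⟨C₀, hC₀, h₀⟩ := exists_norm_heatKernel_le hm0 hm hτ ha
  obtain ⟨C₁, hC₁, h₁⟩ := exists_norm_heatKernelDeriv_le hm0 hm hτ ha
  refine ⟨max C₀ C₁, le_max_of_le_left hC₀, fun t ht htτ s hs0 hspi him => ?_⟩
  have hpi := Real.pi_pos
  have im1 : |s.im| ≤ m * min s.re (2 * Real.pi - s.re) := by
    refine him.trans ?_
    gcongr
    linarith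
  have re2 : ((Real.pi : ℂ) - s).re = Real.pi - s.re := by simp
  have im2 : |((Real.pi : ℂ) - s).im| ≤
      m * min ((Real.pi : ℂ) - s).re (2 * Real.pi - ((Real.pi : ℂ) - s).re) := by
    rw [re2]
    have : |((Real.pi : ℂ) - s).im| = |s.im| := by simp
    rw [this]
    refine him.trans ?_
    rw [min_comm]
    gcongr
    linarith
  have htp : 0 ≤ t ^ (a - 1 / 2) := by positivity
  have hsub : 0 < Real.pi - s.re := by linarith
  constructor
  · refine (norm_le_add_norm _).trans ?_
    have e0 := h₀ t ht htτ s.re hs0 s le_rfl (by linarith) im1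
    have e1 := h₀ t ht htτ (Real.pi - s.re) hsub (Real.pi - s) re2.ge (by rw [re2]; linarith) im2
    simp only [boundaryKernel, PiLp.toLp_apply, Matrix.cons_val_zero, Matrix.cons_val_one, norm_neg]
    calc _ ≤ _ := add_le_add e0 e1
      _ = C₀ * t ^ (a - 1 / 2) * (s.re ^ (-(2 * a)) + (Real.pi - s.re) ^ (-(2 * a))) := by ring
      _ ≤ _ := by gcongr; exact le_max_left _ _
  · refine (norm_le_add_norm _).trans ?_
    have e0 := h₁ t ht htτ s.re hs0 s le_rfl (by linarith) im1
    have e1 := h₁ t ht htτ (Real.pi - s.re) hsub (Real.pi - s) re2.ge (by rw [re2]; linarith) im2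
    simp only [boundaryKernelDeriv, PiLp.toLp_apply, Matrix.cons_val_zero, Matrix.cons_val_one,
      norm_neg]
    calc _ ≤ _ := add_le_add e0 e1
      _ = C₁ * t ^ (a - 1 / 2) * (s.re ^ (-(2 * a + 1)) + (Real.pi - s.re) ^ (-(2 * a + 1))) := by
        ring
      _ ≤ _ := by gcongr; exact le_max_right _ _

/-- A square integrable kernel defines a bounded functional. -/
lemma exists_dotPair_functional {μ : Measure ℝ} {κ : ℝ → EuclideanSpace ℂ (Fin 2)} {w : ℝ → ℝ}
    {B : ℝ} (hκ : AEStronglyMeasurable κ μ) (hw : MemLp w 2 μ)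
    (h : ∀ᵐ σ ∂μ, ‖κ σ‖ ≤ B * ‖w σ‖) :
    ∃ ℓ : Lp (EuclideanSpace ℂ (Fin 2)) 2 μ →L[ℂ] ℂ,
      (∀ u, ℓ u = ∫ σ, dotPair (κ σ) (u σ) ∂μ) ∧ ‖ℓ‖ ≤ B * ‖hw.toLp w‖ := by
  set k : ℝ → EuclideanSpace ℂ (Fin 2) := fun σ => !₂[star (κ σ 0), star (κ σ 1)] with hk
  have hcont : Continuous fun x : EuclideanSpace ℂ (Fin 2) =>
      (!₂[star (x 0), star (x 1)] : EuclideanSpace ℂ (Fin 2)) := by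
    refine (PiLp.continuous_toLp 2 _).comp (continuous_pi fun i => ?_)
    fin_cases i
    · exact continuous_star.comp (PiLp.continuous_apply 2 _ 0)
    · exact continuous_star.comp (PiLp.continuous_apply 2 _ 1)
  have hkm : MemLp k 2 μ := by
    refine hw.of_le_mul (c := B) (hcont.comp_aestronglyMeasurable hκ) ?_
    filter_upwards [h] with σ hσ
    rw [hk, norm_conj_pair]
    exact hσ
  refine ⟨innerSL ℂ (hkm.toLp k), fun u => ?_, ?_⟩
  · rw [innerSL_apply_apply, L2.inner_def]
    refine integral_congr_ae ?_
    filter_upwards [hkm.coeFn_toLp] with σ hσ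
    rw [hσ, dotPair_eq_inner]
  · rw [innerSL_apply_norm]
    refine Lp.norm_le_mul_norm_of_ae_le_mul ?_
    filter_upwards [hkm.coeFn_toLp, hw.coeFn_toLp, h] with σ h1 h2 h3
    rw [h1, h2, hk, norm_conj_pair]
    exact h3

/-! ## The weighted input map -/

/-- In polar coordinates the integrand is y^(1 + r), integrable at 0 because 1 + r > -1. -/
lemma integrableOn_ball_rpow_norm_sub (c : ℂ) {r R : ℝ} (hr : -2 < r) :
    IntegrableOn (fun s : ℂ => ‖c - s‖ ^ r) (Metric.ball c R) := by
  have h0 : IntegrableOn (fun s : ℂ => ‖s‖ ^ r) (Metric.ball (0 : ℂ) R) := by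
    rw [integrableOn_fun_norm_addHaar volume (f := fun y : ℝ => y ^ r), Complex.finrank_real_complex]
    have : IntegrableOn (fun y : ℝ => y ^ (1 + r)) (Ioo 0 R) := by
      rcases le_or_gt R 0 with hR | hR
      · rw [Ioo_eq_empty (not_lt.2 hR)]; exact integrableOn_empty
      · exact (intervalIntegral.integrableOn_Ioo_rpow_iff hR).2 (by linarith)
    refine this.congr_fun (fun y hy => ?_) measurableSet_Ioo
    simp [Real.rpow_add hy.1]
  rw [← integrable_indicator_iff Metric.isOpen_ball.measurableSet] at h0 ⊢
  refine (h0.comp_sub_left c).congr (Filter.Eventually.of_forall fun s => ?_)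
  by_cases hs : s ∈ Metric.ball c R
  · have : c - s ∈ Metric.ball (0 : ℂ) R := by
      rw [mem_ball_zero_iff, ← dist_eq_norm, dist_comm]; exact hs
    simp only [indicator_of_mem hs, indicator_of_mem this]
  · have : c - s ∉ Metric.ball (0 : ℂ) R := by
      rw [mem_ball_zero_iff, ← dist_eq_norm, dist_comm]; exact hs
    simp only [indicator_of_notMem hs, indicator_of_notMem this]

/-- Slope below one gives |Im s| ≤ min (Re s) (π - Re s). The distances to the vertices 0 and π are
thus comparable to Re s and π - Re s, the quantities in the kernel bounds. -/
lemma rhombus_bounds {Θ : ℝ} (hΘ : Real.tan Θ < 1) {s : ℂ} (hs : s ∈ rhombus Θ) :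
    0 < ‖s‖ ∧ 0 < ‖(Real.pi : ℂ) - s‖ ∧ ‖s‖ ≤ 2 * s.re ∧ ‖(Real.pi : ℂ) - s‖ ≤ 2 * (Real.pi - s.re) := by
  obtain ⟨h1, h2, h3⟩ := hs
  have h4 : 0 < min s.re (Real.pi - s.re) := lt_min h1 (by linarith)
  have h5 : |s.im| ≤ min s.re (Real.pi - s.re) := by nlinarith
  have h6 := min_le_left s.re (Real.pi - s.re)
  have h7 := min_le_right s.re (Real.pi - s.re)
  have re2 : ((Real.pi : ℂ) - s).re = Real.pi - s.re := by simp
  have im2 : |((Real.pi : ℂ) - s).im| = |s.im| := by simp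
  refine ⟨h1.trans_le ((le_abs_self _).trans (Complex.abs_re_le_norm s)), ?_, ?_, ?_⟩
  · have := (le_abs_self _).trans (Complex.abs_re_le_norm ((Real.pi : ℂ) - s))
    rw [re2] at this; linarith
  · have := Complex.norm_le_abs_re_add_abs_im s
    rw [abs_of_pos h1] at this; linarith
  · have := Complex.norm_le_abs_re_add_abs_im ((Real.pi : ℂ) - s)
    rw [re2, im2, abs_of_pos (by linarith)] at this; linarith

/-- Near a vertex c the weight behaves like |c - s|^δ, so the question is whether |c - s|^(δ - 2q)
is integrable in the plane. The radius 10 is only a convenient number above 2π. -/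
lemma memLp_bergmanMeasure_of_weight_le {δ Θ q M : ℝ} {c : ℂ}
    (hq : 2 * q - δ < 2) (hc : rhombus Θ ⊆ Metric.ball c 10)
    (hM : ∀ s ∈ rhombus Θ, 0 < ‖c - s‖ ∧
      ‖s‖ ^ δ * ‖(Real.pi : ℂ) - s‖ ^ δ ≤ M * ‖c - s‖ ^ δ) :
    MemLp (fun s : ℂ => ‖c - s‖ ^ (-q)) 2 (bergmanMeasure δ Θ) := by
  have hmeas : Measurable fun s : ℂ => ‖c - s‖ ^ (-q) := by fun_prop
  rw [memLp_two_iff_integrable_sq hmeas.aestronglyMeasurable, bergmanMeasure,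
    restrict_withDensity (isOpen_rhombus Θ).measurableSet,
    integrable_withDensity_iff_integrable_smul' (by fun_prop)
      (Filter.Eventually.of_forall fun s => ENNReal.ofReal_lt_top)]
  have hI : IntegrableOn (fun s : ℂ => M * ‖c - s‖ ^ (δ - 2 * q)) (rhombus Θ) :=
    ((integrableOn_ball_rpow_norm_sub c (R := 10) (by linarith)).mono_set hc).const_mul M
  refine hI.mono' ?_ ?_
  · exact Measurable.aestronglyMeasurable (by fun_prop)
  · filter_upwards [ae_restrict_mem (isOpen_rhombus Θ).measurableSet] with s hs
    obtain ⟨h1, h2⟩ := hM s hs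
    rw [ENNReal.toReal_ofReal (by positivity), smul_eq_mul, Real.norm_of_nonneg (by positivity)]
    calc _ ≤ M * ‖c - s‖ ^ δ * (‖c - s‖ ^ (-q)) ^ 2 := by gcongr
      _ = _ := by
        rw [mul_assoc, ← Real.rpow_natCast, ← Real.rpow_mul h1.le, ← Real.rpow_add h1]
        congr 2; push_cast; ring

lemma memLp_bergman_singular {δ Θ q : ℝ} (hδ : 0 < δ) (hΘ : Real.tan Θ < 1)
    (hq : 2 * q - δ < 2) :
    MemLp (fun s : ℂ => ‖s‖ ^ (-q)) 2 (bergmanMeasure δ Θ) ∧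
      MemLp (fun s : ℂ => ‖(Real.pi : ℂ) - s‖ ^ (-q)) 2 (bergmanMeasure δ Θ) := by
  have hpi := Real.pi_lt_four
  constructor
  · have := memLp_bergmanMeasure_of_weight_le (Θ := Θ) (q := q) (M := 10 ^ δ) (c := 0) hq
      (fun s hs => by
        obtain ⟨-, -, h3, -⟩ := rhombus_bounds hΘ hs
        rw [mem_ball_zero_iff]; linarith [hs.2.1])
      (fun s hs => by
        obtain ⟨h1, h2, h3, h4⟩ := rhombus_bounds hΘ hs
        rw [zero_sub, norm_neg, mul_comm]
        refine ⟨h1, ?_⟩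
        gcongr
        linarith [hs.1])
    simpa using this
  · exact memLp_bergmanMeasure_of_weight_le (Θ := Θ) (q := q) (M := 10 ^ δ) (c := Real.pi) hq
      (fun s hs => by
        obtain ⟨-, -, -, h4⟩ := rhombus_bounds hΘ hs
        rw [Metric.mem_ball, dist_comm, dist_eq_norm]; linarith [hs.1])
      (fun s hs => by
        obtain ⟨h1, h2, h3, h4⟩ := rhombus_bounds hΘ hs
        refine ⟨h2, ?_⟩
        gcongr
        linarith [hs.2.1])

lemma memLp_two_sub_rpow {τ r : ℝ} (hτ : 0 < τ) (hr : -(1 / 2) < r) :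
    MemLp (fun σ : ℝ => (τ - σ) ^ r) 2 ((volume : Measure ℝ).restrict (Icc 0 τ)) := by
  have hmeas : Measurable fun σ : ℝ => (τ - σ) ^ r := by fun_prop
  rw [memLp_two_iff_integrable_sq hmeas.aestronglyMeasurable]
  have h : IntervalIntegrable (fun σ : ℝ => σ ^ (2 * r)) volume 0 τ :=
    intervalIntegral.intervalIntegrable_rpow' (by linarith)
  have h2 := (h.comp_sub_left τ).symm
  rw [sub_zero, sub_self, intervalIntegrable_iff_integrableOn_Icc_of_le hτ.le] at h2
  refine h2.congr_fun (fun σ hσ => ?_) measurableSet_Icc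
  have : 0 ≤ τ - σ := by linarith [hσ.2]
  simp only
  rw [← Real.rpow_natCast, ← Real.rpow_mul this]; congr 1; push_cast; ring

lemma ae_restrict_Icc_sub_pos (τ : ℝ) :
    ∀ᵐ σ ∂((volume : Measure ℝ).restrict (Icc 0 τ)), 0 < τ - σ ∧ τ - σ ≤ τ := by
  have h : ∀ᵐ σ ∂((volume : Measure ℝ).restrict (Icc 0 τ)), σ ≠ τ :=
    ae_restrict_of_ae (by simp [ae_iff])
  filter_upwards [h, ae_restrict_mem measurableSet_Icc] with σ h1 h2
  exact ⟨sub_pos.2 (lt_of_le_of_ne h2.2 h1), by linarith [h2.1]⟩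

/-- The kernel of the weighted input map. -/
def weightedKernel (τ γ : ℝ) (s : ℂ) (σ : ℝ) : EuclideanSpace ℂ (Fin 2) :=
  (τ - σ) ^ (-γ) • boundaryKernel (τ - σ) s

/-- The derivative of `weightedKernel` in `s`. -/
def weightedKernelDeriv (τ γ : ℝ) (s : ℂ) (σ : ℝ) : EuclideanSpace ℂ (Fin 2) :=
  (τ - σ) ^ (-γ) • boundaryKernelDeriv (τ - σ) s

lemma measurable_weightedKernel (τ γ : ℝ) (s : ℂ) : Measurable (weightedKernel τ γ s) := by
  have h : Measurable fun σ : ℝ => boundaryKernel (τ - σ) s :=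
    measurable_boundaryKernel.comp (g := fun p : ℝ × ℂ => boundaryKernel p.1 p.2)
      (f := fun σ : ℝ => (τ - σ, s)) (by fun_prop)
  exact (show Measurable fun σ : ℝ => (τ - σ) ^ (-γ) by fun_prop).smul h

lemma measurable_weightedKernelDeriv (τ γ : ℝ) (s : ℂ) :
    Measurable (weightedKernelDeriv τ γ s) := by
  have h : Measurable fun σ : ℝ => boundaryKernelDeriv (τ - σ) s :=
    measurable_boundaryKernelDeriv.comp (g := fun p : ℝ × ℂ => boundaryKernelDeriv p.1 p.2)
      (f := fun σ : ℝ => (τ - σ, s)) (by fun_prop)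
  exact (show Measurable fun σ : ℝ => (τ - σ) ^ (-γ) by fun_prop).smul h

lemma dotPair_smul_left (c : ℝ) (x y : EuclideanSpace ℂ (Fin 2)) :
    dotPair (c • x) y = c * dotPair x y := by
  simp only [dotPair, PiLp.smul_apply, Complex.real_smul]; ring

lemma dotPair_smul_right (c : ℝ) (x y : EuclideanSpace ℂ (Fin 2)) :
    dotPair x ((c : ℂ) • y) = c * dotPair x y := by
  simp only [dotPair, PiLp.smul_apply, smul_eq_mul]; ring

lemma hasDerivAt_dotPair_weightedKernel (τ γ σ : ℝ) (s : ℂ) (y : EuclideanSpace ℂ (Fin 2)) :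
    HasDerivAt (fun s => dotPair (weightedKernel τ γ s σ) y)
      (dotPair (weightedKernelDeriv τ γ s σ) y) s := by
  simp only [weightedKernel, weightedKernelDeriv, dotPair_smul_left]
  exact (hasDerivAt_dotPair_boundaryKernel _ s y).const_mul _

lemma exists_norm_weightedKernel_le {τ Θ a : ℝ} (γ : ℝ) (hτ : 0 < τ) (hΘ0 : 0 ≤ Real.tan Θ)
    (hΘ : Real.tan Θ < 1) (ha : 0 < a) :
    ∃ C : ℝ, 0 ≤ C ∧ ∀ s ∈ rhombus Θ, ∀ σ : ℝ, 0 < τ - σ → τ - σ ≤ τ →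
      ‖weightedKernel τ γ s σ‖ ≤
          C * (s.re ^ (-(2 * a + 1)) + (Real.pi - s.re) ^ (-(2 * a + 1))) *
            ‖(τ - σ) ^ (a - 1 / 2 - γ)‖ ∧
        ‖weightedKernelDeriv τ γ s σ‖ ≤
          C * (s.re ^ (-(2 * a + 1)) + (Real.pi - s.re) ^ (-(2 * a + 1))) *
            ‖(τ - σ) ^ (a - 1 / 2 - γ)‖ := by
  obtain ⟨C, hC0, hC⟩ := exists_norm_boundaryKernel_le hΘ0 hΘ hτ ha
  -- The factor π absorbs y^(-2a) ≤ π y^(-(2a + 1)) for 0 < y ≤ π, so that one majorant serves the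
  -- kernel and its derivative.
  refine ⟨C * Real.pi, by positivity, fun s hs σ h0 h1 => ?_⟩
  obtain ⟨e1, e2⟩ := hC (τ - σ) h0 h1 s hs.1 hs.2.1 hs.2.2.le
  have hpi := Real.pi_gt_three
  have hx := hs.1
  have hx' : 0 < Real.pi - s.re := sub_pos.2 hs.2.1
  have hw : (τ - σ) ^ (a - 1 / 2 - γ) = (τ - σ) ^ (-γ) * (τ - σ) ^ (a - 1 / 2) := by
    rw [← Real.rpow_add h0]; congr 1; ring
  have hpow : ∀ y : ℝ, 0 < y → y ≤ Real.pi → y ^ (-(2 * a)) ≤ Real.pi * y ^ (-(2 * a + 1)) := by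
    intro y hy hy'
    have : y ^ (-(2 * a)) = y * y ^ (-(2 * a + 1)) := by
      rw [← Real.rpow_one_add' hy.le (by linarith)]; congr 1; ring
    rw [this]; gcongr
  have p1 := hpow s.re hx (by linarith)
  have p2 := hpow (Real.pi - s.re) hx' (by linarith)
  rw [Real.norm_of_nonneg (by positivity), hw, weightedKernel, weightedKernelDeriv, norm_smul,
    norm_smul, Real.norm_of_nonneg (by positivity)]
  constructor
  · calc _ ≤ (τ - σ) ^ (-γ) * (C * (τ - σ) ^ (a - 1 / 2) *
        (Real.pi * s.re ^ (-(2 * a + 1)) + Real.pi * (Real.pi - s.re) ^ (-(2 * a + 1)))) := by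
          refine mul_le_mul_of_nonneg_left (e1.trans ?_) (by positivity)
          gcongr
      _ = _ := by ring
  · calc _ ≤ (τ - σ) ^ (-γ) * (C * (τ - σ) ^ (a - 1 / 2) *
        (Real.pi * (s.re ^ (-(2 * a + 1)) + (Real.pi - s.re) ^ (-(2 * a + 1))))) := by
          refine mul_le_mul_of_nonneg_left (e2.trans ?_) (by positivity)
          gcongr
          exact le_mul_of_one_le_left (by positivity) (by linarith)
      _ = _ := by ring

lemma IsHolomorphicRep.congr {δ Θ : ℝ} {p : BergmanPair δ Θ} {F G : ℂ → ℂ}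
    (h : IsHolomorphicRep p F) (hFG : EqOn F G (rhombus Θ)) : IsHolomorphicRep p G := by
  obtain ⟨h1, h2, h3⟩ := h
  refine ⟨h1.congr fun s hs => (hFG hs).symm, ?_, ?_⟩
  · filter_upwards [h2, ae_bergmanMeasure_mem δ Θ] with s e hs
    rw [e, hFG hs]
  · filter_upwards [h3, ae_bergmanMeasure_mem δ Θ] with s e hs
    rw [e]
    exact (Filter.eventuallyEq_of_mem ((isOpen_rhombus Θ).mem_nhds hs) hFG).deriv_eq

/-- The weighted input map. -/
theorem exists_weightedInputMap {τ δ Θ γ : ℝ} (hτ : 0 < τ) (hδ : 0 < δ) (hΘ0 : 0 ≤ Real.tan Θ)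
    (hΘ : Real.tan Θ < 1) (hγ0 : 0 ≤ γ) (hγ : γ < δ / 4) :
    ∃ L : InputSpace τ →L[ℂ] BergmanSobolev δ Θ,
      (∀ u, IsHolomorphicRep (L u : BergmanPair δ Θ) fun s =>
        ∫ σ in Icc 0 τ, dotPair (weightedKernel τ γ s σ) (u σ)) ∧
      ∀ (ι : Type) (b : ι → InputSpace τ) (M : ℝ), 0 ≤ M → IsBesselFamily b M →
        Summable fun i => ‖L (b i)‖ ^ 2 := by
  -- The midpoint of γ and δ/4: a > γ puts (τ - σ)^(a - 1/2 - γ) in L² in time, and a < δ/4 puts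
  -- |s|^(-(2a + 1)) in L² for ρ_δ dA.
  set a : ℝ := (γ + δ / 4) / 2 with ha
  have ha0 : 0 < a := by rw [ha]; positivity
  set q : ℝ := 2 * a + 1 with hq
  obtain ⟨C, hC0, hC⟩ := exists_norm_weightedKernel_le γ hτ hΘ0 hΘ ha0
  have hw := memLp_two_sub_rpow (r := a - 1 / 2 - γ) hτ (by rw [ha]; linarith)
  obtain ⟨hB1, hB2⟩ := memLp_bergman_singular (q := q) hδ hΘ (by rw [hq, ha]; linarith)
  set μ := (volume : Measure ℝ).restrict (Icc 0 τ) with hμ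
  set P : ℂ → ℝ := fun s => s.re ^ (-q) + (Real.pi - s.re) ^ (-q) with hP
  have hP0 : ∀ s ∈ rhombus Θ, 0 ≤ P s := fun s hs => by
    have h1 := hs.1
    have h2 : 0 < Real.pi - s.re := sub_pos.2 hs.2.1
    positivity
  have hbound : ∀ s ∈ rhombus Θ, ∀ᵐ σ ∂μ, ‖weightedKernel τ γ s σ‖ ≤
      C * P s * ‖(τ - σ) ^ (a - 1 / 2 - γ)‖ ∧ ‖weightedKernelDeriv τ γ s σ‖ ≤
      C * P s * ‖(τ - σ) ^ (a - 1 / 2 - γ)‖ := fun s hs => by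
    filter_upwards [ae_restrict_Icc_sub_pos τ] with σ hσ
    exact hC s hs σ hσ.1 hσ.2
  -- Off the rhombus these functionals are arbitrary; the integral formula is invoked only locally,
  -- on an open set.
  choose! ψ hψ1 hψ2 using fun s hs => exists_dotPair_functional
    (measurable_weightedKernel τ γ s).aestronglyMeasurable hw
    ((hbound s hs).mono fun σ h => h.1)
  choose! ψ' hψ'1 hψ'2 using fun s hs => exists_dotPair_functional
    (measurable_weightedKernelDeriv τ γ s).aestronglyMeasurable hw
    ((hbound s hs).mono fun σ h => h.2)
  set W : ℝ := ‖hw.toLp (fun σ : ℝ => (τ - σ) ^ (a - 1 / 2 - γ))‖ with hW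
  have hPle : ∀ s ∈ rhombus Θ, C * P s * W ≤
      C * W * 2 ^ q * (‖s‖ ^ (-q) + ‖(Real.pi : ℂ) - s‖ ^ (-q)) := fun s hs => by
    obtain ⟨h1, h2, h3, h4⟩ := rhombus_bounds hΘ hs
    have key : ∀ x y : ℝ, 0 < x → 0 < y → y ≤ 2 * x → x ^ (-q) ≤ 2 ^ q * y ^ (-q) := by
      intro x y hx hy hxy
      have h5 : (2 * x) ^ (-q) ≤ y ^ (-q) :=
        Real.rpow_le_rpow_of_nonpos hy hxy (by rw [hq]; linarith)
      rw [Real.mul_rpow (by norm_num) hx.le, Real.rpow_neg (by norm_num)] at h5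
      calc x ^ (-q) = 2 ^ q * ((2 ^ q)⁻¹ * x ^ (-q)) := by
            rw [mul_inv_cancel_left₀ (by positivity)]
        _ ≤ _ := by gcongr
    have k1 := key _ _ hs.1 h1 h3
    have k2 := key _ _ (sub_pos.2 hs.2.1) h2 h4
    calc C * P s * W ≤ C * (2 ^ q * ‖s‖ ^ (-q) + 2 ^ q * ‖(Real.pi : ℂ) - s‖ ^ (-q)) * W := by
          simp only [hP]; gcongr
      _ = _ := by ring
  have hder : ∀ s ∈ rhombus Θ, ∀ u, HasDerivAt (fun s => ψ s u) (ψ' s u) s := by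
    intro s₀ hs₀ u
    have hnhds := (isOpen_rhombus Θ).mem_nhds hs₀
    have hev : (fun s => ψ s u) =ᶠ[nhds s₀] fun s => ∫ σ, dotPair (weightedKernel τ γ s σ) (u σ) ∂μ :=
      Filter.eventuallyEq_of_mem hnhds fun s hs => hψ1 s hs u
    rw [hψ'1 s₀ hs₀ u]
    refine HasDerivAt.congr_of_eventuallyEq ?_ hev
    have hu : MemLp (fun σ => u σ) 2 μ := Lp.memLp u
    have hwu : Integrable (fun σ => ‖(τ - σ) ^ (a - 1 / 2 - γ)‖ * ‖u σ‖) μ :=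
      hw.norm.integrable_mul hu.norm
    have hpair : ∀ κ : ℝ → EuclideanSpace ℂ (Fin 2), Measurable κ →
        AEStronglyMeasurable (fun σ => dotPair (κ σ) (u σ)) μ := fun κ hκ => by
      have hcoord : ∀ i : Fin 2, Measurable fun x : EuclideanSpace ℂ (Fin 2) => x i := fun i =>
        (PiLp.continuous_apply 2 _ i).measurable
      have hcoord' : ∀ i : Fin 2, AEStronglyMeasurable (fun σ => u σ i) μ := fun i =>
        (PiLp.continuous_apply 2 _ i).comp_aestronglyMeasurable hu.1
      exact (((hcoord 0).comp hκ).aestronglyMeasurable.mul (hcoord' 0)).add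
        (((hcoord 1).comp hκ).aestronglyMeasurable.mul (hcoord' 1))
    have hcontP : ContinuousAt P s₀ := by
      have h1 : ContinuousAt (fun s : ℂ => s.re ^ (-q)) s₀ :=
        Complex.continuous_re.continuousAt.rpow_const (Or.inl hs₀.1.ne')
      have h2 : ContinuousAt (fun s : ℂ => (Real.pi - s.re) ^ (-q)) s₀ :=
        (continuous_const.sub Complex.continuous_re).continuousAt.rpow_const
          (Or.inl (sub_pos.2 hs₀.2.1).ne')
      exact h1.add h2
    -- On this neighbourhood the spatial factor is bounded, which yields a majorant independent of s
    -- for differentiation under the integral.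
    have hN : {s | s ∈ rhombus Θ ∧ P s < P s₀ + 1} ∈ nhds s₀ :=
      Filter.inter_mem hnhds (hcontP.eventually (gt_mem_nhds (by linarith)))
    refine (hasDerivAt_integral_of_dominated_loc_of_deriv_le
      (F := fun s σ => dotPair (weightedKernel τ γ s σ) (u σ))
      (F' := fun s σ => dotPair (weightedKernelDeriv τ γ s σ) (u σ))
      (bound := fun σ => C * (P s₀ + 1) * (‖(τ - σ) ^ (a - 1 / 2 - γ)‖ * ‖u σ‖))
      hN ?_ ?_ ?_ ?_ (hwu.const_mul _) ?_).2
    · exact Filter.Eventually.of_forall fun s => hpair _ (measurable_weightedKernel τ γ s)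
    · refine (hwu.const_mul (C * P s₀)).mono' (hpair _ (measurable_weightedKernel τ γ s₀)) ?_
      filter_upwards [hbound s₀ hs₀] with σ hσ
      refine (norm_dotPair_le _ _).trans ?_
      rw [← mul_assoc]
      gcongr
      exact hσ.1
    · exact hpair _ (measurable_weightedKernelDeriv τ γ s₀)
    · filter_upwards [ae_restrict_Icc_sub_pos τ] with σ hσ s hs
      refine (norm_dotPair_le _ _).trans ?_
      rw [← mul_assoc]
      gcongr
      exact (hC s hs.1 σ hσ.1 hσ.2).2.trans
        (mul_le_mul_of_nonneg_right (mul_le_mul_of_nonneg_left hs.2.le hC0) (norm_nonneg _))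
    · exact Filter.Eventually.of_forall fun σ s _ => hasDerivAt_dotPair_weightedKernel τ γ σ s _
  obtain ⟨L, hL1, hL2⟩ := exists_bergman_operator (δ := δ) (Θ := Θ) ψ ψ'
    (fun s => C * W * 2 ^ q * (‖s‖ ^ (-q) + ‖(Real.pi : ℂ) - s‖ ^ (-q))) hder
    ((hB1.add hB2).const_mul _) (fun s hs => (hψ2 s hs).trans (hPle s hs))
    (fun s hs => (hψ'2 s hs).trans (hPle s hs))
  exact ⟨L, fun u => (hL1 u).congr fun s hs => hψ1 s hs u, hL2⟩

/-! ## Integration by parts for indefinite integrals -/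

/-- Fubini on the triangle y ≤ x. This gives integration by parts for functions that are merely
integrable, without pointwise derivatives. -/
lemma integral_mul_primitive {b : ℝ} (hb : 0 ≤ b) {f g : ℝ → ℂ}
    (hf : IntervalIntegrable f volume 0 b) (hg : IntervalIntegrable g volume 0 b) :
    ∫ x in (0 : ℝ)..b, f x * (∫ y in (0 : ℝ)..x, g y) =
      (∫ x in (0 : ℝ)..b, f x) * (∫ y in (0 : ℝ)..b, g y) -
        ∫ y in (0 : ℝ)..b, (∫ x in (0 : ℝ)..y, f x) * g y := by
  have hf' := (intervalIntegrable_iff_integrableOn_Ioc_of_le hb).1 hf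
  have hg' := (intervalIntegrable_iff_integrableOn_Ioc_of_le hb).1 hg
  set μ := (volume : Measure ℝ).restrict (Ioc 0 b) with hμ
  have hprod : Integrable (fun p : ℝ × ℝ => f p.1 * g p.2) (μ.prod μ) := hf'.mul_prod hg'
  have hS : MeasurableSet {p : ℝ × ℝ | p.2 ≤ p.1} := measurableSet_le measurable_snd measurable_fst
  have hswap := integral_integral_swap
    (f := fun x y : ℝ => {p : ℝ × ℝ | p.2 ≤ p.1}.indicator (fun p => f p.1 * g p.2) (x, y))
    (hprod.indicator hS)
  have hL : ∀ x ∈ Ioc 0 b, ∫ y, {p : ℝ × ℝ | p.2 ≤ p.1}.indicator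
      (fun p => f p.1 * g p.2) (x, y) ∂μ = f x * ∫ y in (0 : ℝ)..x, g y := by
    intro x hx
    have h1 : (fun y => {p : ℝ × ℝ | p.2 ≤ p.1}.indicator (fun p => f p.1 * g p.2) (x, y)) =
        fun y => f x * (Iic x).indicator g y := by
      ext y
      by_cases hy : y ≤ x <;> simp [indicator, hy]
    rw [h1, integral_const_mul, integral_indicator measurableSet_Iic, hμ,
      Measure.restrict_restrict measurableSet_Iic, intervalIntegral.integral_of_le hx.1.le]
    have h2 : Iic x ∩ Ioc 0 b = Ioc 0 x := by
      ext y; simp only [mem_inter_iff, mem_Iic, mem_Ioc]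
      exact ⟨fun h => ⟨h.2.1, h.1⟩, fun h => ⟨h.2, h.1, h.2.trans hx.2⟩⟩
    rw [h2]
  have hR : ∀ y ∈ Ioc 0 b, ∫ x, {p : ℝ × ℝ | p.2 ≤ p.1}.indicator
      (fun p => f p.1 * g p.2) (x, y) ∂μ =
      (∫ x in (0 : ℝ)..b, f x) * g y - (∫ x in (0 : ℝ)..y, f x) * g y := by
    intro y hy
    have h1 : (fun x => {p : ℝ × ℝ | p.2 ≤ p.1}.indicator (fun p => f p.1 * g p.2) (x, y)) =
        fun x => (Ici y).indicator f x * g y := by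
      ext x
      by_cases hx : y ≤ x <;> simp [indicator, hx]
    have hfy : IntervalIntegrable f volume 0 y := hf.mono_set (by
      rw [uIcc_of_le hy.1.le, uIcc_of_le hb]; exact Icc_subset_Icc_right hy.2)
    have hyb : IntervalIntegrable f volume y b := hf.mono_set (by
      rw [uIcc_of_le hy.2, uIcc_of_le hb]; exact Icc_subset_Icc_left hy.1.le)
    rw [h1, integral_mul_const, integral_indicator measurableSet_Ici, hμ,
      Measure.restrict_restrict measurableSet_Ici, ← sub_mul,
      ← intervalIntegral.integral_add_adjacent_intervals hfy hyb, add_sub_cancel_left,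
      intervalIntegral.integral_of_le hy.2, ← integral_Icc_eq_integral_Ioc]
    have h2 : Ici y ∩ Ioc 0 b = Icc y b := by
      ext x; simp only [mem_inter_iff, mem_Ici, mem_Ioc, mem_Icc]
      exact ⟨fun h => ⟨h.1, h.2.2⟩, fun h => ⟨h.1, hy.1.trans_le h.1, h.2⟩⟩
    rw [h2]
  have hcont : ContinuousOn (fun y => ∫ x in (0 : ℝ)..y, f x) (uIcc 0 b) :=
    intervalIntegral.continuousOn_primitive_interval
      (by rw [uIcc_of_le hb]; exact (intervalIntegrable_iff_integrableOn_Icc_of_le hb).1 hf)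
  have hint : IntervalIntegrable (fun y => (∫ x in (0 : ℝ)..y, f x) * g y) volume 0 b :=
    hg.continuousOn_mul hcont
  rw [intervalIntegral.integral_of_le hb, ← setIntegral_congr_fun measurableSet_Ioc hL, hswap,
    setIntegral_congr_fun measurableSet_Ioc hR, ← intervalIntegral.integral_of_le hb,
    intervalIntegral.integral_sub (hg.const_mul _) hint, intervalIntegral.integral_const_mul]

lemma integral_mul_eq_of_primitive {b : ℝ} (hb : 0 ≤ b) {F f G g : ℝ → ℂ}
    (hf : IntervalIntegrable f volume 0 b) (hg : IntervalIntegrable g volume 0 b)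
    (hF : ∀ x ∈ Icc 0 b, F x = F 0 + ∫ y in (0 : ℝ)..x, f y)
    (hG : ∀ x ∈ Icc 0 b, G x = G 0 + ∫ y in (0 : ℝ)..x, g y) :
    ∫ x in (0 : ℝ)..b, F x * g x = F b * G b - F 0 * G 0 - ∫ x in (0 : ℝ)..b, f x * G x := by
  have hb' : b ∈ Icc 0 b := ⟨hb, le_rfl⟩
  have hcont : ∀ {h : ℝ → ℂ}, IntervalIntegrable h volume 0 b →
      ContinuousOn (fun y => ∫ x in (0 : ℝ)..y, h x) (uIcc 0 b) := fun {h} hh =>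
    intervalIntegral.continuousOn_primitive_interval
      (by rw [uIcc_of_le hb]; exact (intervalIntegrable_iff_integrableOn_Icc_of_le hb).1 hh)
  have h1 : ∫ x in (0 : ℝ)..b, F x * g x =
      F 0 * (∫ x in (0 : ℝ)..b, g x) + ∫ x in (0 : ℝ)..b, (∫ y in (0 : ℝ)..x, f y) * g x := by
    rw [← intervalIntegral.integral_const_mul,
      ← intervalIntegral.integral_add (hg.const_mul _) (hg.continuousOn_mul (hcont hf))]
    refine intervalIntegral.integral_congr fun x hx => ?_
    rw [uIcc_of_le hb] at hx
    rw [hF x hx]; ring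
  have h2 : ∫ x in (0 : ℝ)..b, f x * G x =
      (∫ x in (0 : ℝ)..b, f x) * G 0 + ∫ x in (0 : ℝ)..b, f x * (∫ y in (0 : ℝ)..x, g y) := by
    rw [← intervalIntegral.integral_mul_const,
      ← intervalIntegral.integral_add (hf.mul_const _) (hf.mul_continuousOn (hcont hg))]
    refine intervalIntegral.integral_congr fun x hx => ?_
    rw [uIcc_of_le hb] at hx
    rw [hG x hx]; ring
  rw [h1, h2, integral_mul_primitive hb hf hg, hF b hb', hG b hb']
  ring

lemma eq_primitive_of_hasDerivAt {F f : ℝ → ℂ} (h : ∀ x, HasDerivAt F (f x) x)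
    (hf : Continuous f) (x : ℝ) : F x = F 0 + ∫ y in (0 : ℝ)..x, f y := by
  rw [intervalIntegral.integral_eq_sub_of_hasDerivAt (fun y _ => h y)
    (hf.intervalIntegrable _ _)]
  ring

lemma hasDerivAt_cexp_ofReal_mul (c : ℂ) (x : ℝ) :
    HasDerivAt (fun x : ℝ => Complex.exp (c * x)) (c * Complex.exp (c * x)) x := by
  have h : HasDerivAt (fun x : ℝ => c * (x : ℂ)) c x := by
    simpa using (Complex.ofRealCLM.hasDerivAt (x := x)).const_mul c
  simpa [mul_comm] using h.cexp

/-- The only solution of the scalar equation `y = c ∫₀ y` is zero. -/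
lemma eq_zero_of_eq_mul_integral {τ : ℝ} {c : ℂ} {y : ℝ → ℂ}
    (hy : ContinuousOn y (Icc 0 τ)) (h : ∀ t ∈ Icc 0 τ, y t = c * ∫ s in (0 : ℝ)..t, y s) :
    ∀ t ∈ Icc 0 τ, y t = 0 := by
  intro t ht
  have hsub : Icc 0 t ⊆ Icc 0 τ := Icc_subset_Icc_right ht.2
  have hyint : IntervalIntegrable y volume 0 t :=
    ContinuousOn.intervalIntegrable (by rw [uIcc_of_le ht.1]; exact hy.mono hsub)
  have hexp : Continuous fun x : ℝ => -c * Complex.exp (-c * x) := by fun_prop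
  -- Integrating factor: the parts formula for e^(-cx) against ∫₀ˣ y has the same integral on both
  -- sides, leaving e^(-ct) ∫₀ᵗ y = 0.
  have key := integral_mul_eq_of_primitive ht.1 (F := fun x : ℝ => Complex.exp (-c * x))
    (G := fun x => ∫ s in (0 : ℝ)..x, y s) (hexp.intervalIntegrable _ _) hyint
    (fun x _ => eq_primitive_of_hasDerivAt (hasDerivAt_cexp_ofReal_mul (-c)) hexp x)
    (fun x _ => by simp)
  have h2 : ∫ x in (0 : ℝ)..t, -c * Complex.exp (-c * x) * (∫ s in (0 : ℝ)..x, y s) =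
      -∫ x in (0 : ℝ)..t, Complex.exp (-c * x) * y x := by
    rw [← intervalIntegral.integral_neg]
    refine intervalIntegral.integral_congr fun x hx => ?_
    rw [uIcc_of_le ht.1] at hx
    rw [h x (hsub hx)]; ring
  rw [h2] at key
  have h3 : Complex.exp (-c * t) * ∫ s in (0 : ℝ)..t, y s = 0 := by
    simp only [intervalIntegral.integral_same, mul_zero, sub_zero, sub_neg_eq_add] at key
    exact left_eq_add.mp (by rw [add_comm]; exact key)
  rw [h t ht, (mul_eq_zero.1 h3).resolve_left (Complex.exp_ne_zero _), mul_zero]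

/-! ## Completeness of the cosines -/

lemma integrableOn_mul_of_continuous {f : ℝ → ℂ} (hf : IntegrableOn f (Ioo 0 Real.pi)) {g : ℝ → ℂ}
    (hg : Continuous g) : IntegrableOn (fun x => f x * g x) (Ioo 0 Real.pi) := by
  obtain ⟨C, hC⟩ := isCompact_Icc.exists_bound_of_continuousOn (s := Icc 0 Real.pi) hg.continuousOn
  refine hf.mul_bdd (c := C) hg.aestronglyMeasurable ?_
  filter_upwards [ae_restrict_mem measurableSet_Ioo] with x hx
  exact hC x (Ioo_subset_Icc_self hx)

/-- Induction on k through 2 cos x cos((m + 1)x) = cos((m + 2)x) + cos(mx). At m = 0 one factor cos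
x is read as cos(1·x). -/
lemma integral_mul_cos_pow_mul_cos_eq_zero {f : ℝ → ℂ} (hf : IntegrableOn f (Ioo 0 Real.pi))
    (h : ∀ m : ℕ, ∫ x in Ioo 0 Real.pi, f x * Real.cos (m * x) = 0) (k : ℕ) :
    ∀ m : ℕ, ∫ x in Ioo 0 Real.pi, f x * ((Real.cos x ^ k * Real.cos (m * x) : ℝ) : ℂ) = 0 := by
  induction k with
  | zero => intro m; simpa using h m
  | succ k ih =>
    intro m
    rcases m with _ | m
    · have := ih 1
      simpa [pow_succ] using this
    · have h1 := ih (m + 2)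
      have h2 := ih m
      have e : ∀ x : ℝ, f x * ((Real.cos x ^ (k + 1) * Real.cos ((m + 1 : ℕ) * x) : ℝ) : ℂ) =
          2⁻¹ * (f x * ((Real.cos x ^ k * Real.cos ((m + 2 : ℕ) * x) : ℝ) : ℂ)) +
          2⁻¹ * (f x * ((Real.cos x ^ k * Real.cos (m * x) : ℝ) : ℂ)) := by
        intro x
        have c1 : Real.cos ((m + 2 : ℕ) * x) = Real.cos ((m + 1 : ℕ) * x) * Real.cos x -
            Real.sin ((m + 1 : ℕ) * x) * Real.sin x := by
          rw [← Real.cos_add]; congr 1; push_cast; ring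
        have c2 : Real.cos (m * x) = Real.cos ((m + 1 : ℕ) * x) * Real.cos x +
            Real.sin ((m + 1 : ℕ) * x) * Real.sin x := by
          rw [← Real.cos_sub]; congr 1; push_cast; ring
        rw [c1, c2]
        push_cast
        ring
      simp_rw [e]
      rw [integral_add, integral_const_mul, integral_const_mul, h1, h2]
      · simp
      · exact (integrableOn_mul_of_continuous hf (by fun_prop)).const_mul _
      · exact (integrableOn_mul_of_continuous hf (by fun_prop)).const_mul _

/-- f annihilates all polynomials in cos x. On (0, π) a continuous g is (g ∘ arccos) ∘ cos, so
Weierstrass approximation on [-1, 1] extends this to every continuous g, in particular to smooth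
compactly supported ones. -/
lemma ae_eq_zero_of_integral_cos_eq_zero {f : ℝ → ℂ} (hf : IntegrableOn f (Ioo 0 Real.pi))
    (h : ∀ m : ℕ, ∫ x in Ioo 0 Real.pi, f x * Real.cos (m * x) = 0) :
    ∀ᵐ x ∂((volume : Measure ℝ).restrict (Ioo 0 Real.pi)), f x = 0 := by
  have hpoly : ∀ p : Polynomial ℝ,
      ∫ x in Ioo 0 Real.pi, f x * ((p.eval (Real.cos x) : ℝ) : ℂ) = 0 := by
    intro p
    induction p using Polynomial.induction_on' with
    | add p q hp hq =>
      simp only [Polynomial.eval_add, Complex.ofReal_add, mul_add]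
      rw [integral_add (integrableOn_mul_of_continuous hf (by fun_prop))
        (integrableOn_mul_of_continuous hf (by fun_prop)), hp, hq, add_zero]
    | monomial n a =>
      have := integral_mul_cos_pow_mul_cos_eq_zero hf h n 0
      simp only [Polynomial.eval_monomial]
      have e : ∀ x : ℝ, f x * ((a * Real.cos x ^ n : ℝ) : ℂ) =
          a * (f x * ((Real.cos x ^ n * Real.cos ((0 : ℕ) * x) : ℝ) : ℂ)) := by
        intro x; push_cast; simp; ring
      simp_rw [e]
      rw [integral_const_mul, this, mul_zero]
  have hcont : ∀ g : ℝ → ℝ, Continuous g → ∫ x in Ioo 0 Real.pi, f x * (g x : ℂ) = 0 := by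
    intro g hg
    set I := ∫ x in Ioo 0 Real.pi, ‖f x‖ with hI
    have hI0 : 0 ≤ I := integral_nonneg fun x => norm_nonneg _
    rw [← norm_le_zero_iff]
    refine le_of_forall_pos_le_add fun ε hε => ?_
    obtain ⟨p, hp⟩ := exists_polynomial_near_of_continuousOn (-1) 1 (fun y => g (Real.arccos y))
      (hg.comp Real.continuous_arccos).continuousOn (ε / (I + 1)) (by positivity)
    have e : ∫ x in Ioo 0 Real.pi, f x * (g x : ℂ) =
        ∫ x in Ioo 0 Real.pi, f x * ((g x - p.eval (Real.cos x) : ℝ) : ℂ) := by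
      simp only [Complex.ofReal_sub, mul_sub]
      rw [integral_sub (integrableOn_mul_of_continuous hf (by fun_prop))
        (integrableOn_mul_of_continuous hf (by fun_prop)), hpoly p, sub_zero]
    rw [e, zero_add]
    calc _ ≤ ∫ x in Ioo 0 Real.pi, ‖f x‖ * (ε / (I + 1)) := by
          refine norm_integral_le_of_norm_le (hf.norm.mul_const _) ?_
          filter_upwards [ae_restrict_mem measurableSet_Ioo] with x hx
          rw [norm_mul, Complex.norm_real]
          gcongr
          have := hp (Real.cos x) ⟨Real.neg_one_le_cos x, Real.cos_le_one x⟩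
          rw [Real.arccos_cos hx.1.le hx.2.le] at this
          rw [Real.norm_eq_abs, abs_sub_comm]
          exact this.le
      _ = I * (ε / (I + 1)) := by rw [integral_mul_const]
      _ ≤ ε := by
          rw [mul_div_assoc', div_le_iff₀ (by positivity)]
          nlinarith
  have := isOpen_Ioo.ae_eq_zero_of_integral_contDiff_smul_eq_zero (μ := volume)
    (hf.locallyIntegrableOn) (fun g hg _ hsupp => by
      rw [← hcont g hg.continuous, ← setIntegral_eq_integral_of_forall_compl_eq_zero (s := Ioo 0 Real.pi)]
      · simp only [Complex.real_smul, mul_comm]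
      · intro x hx
        have : g x = 0 := by
          by_contra hne
          exact hx (hsupp (subset_tsupport _ hne))
        rw [this, zero_smul])
  rw [ae_restrict_iff' measurableSet_Ioo]
  exact this

/-! ## The weak equation, tested with cosines -/

/-- Continuity of the pairing with a fixed test function lets it pass through limits and Bochner
integrals in time. -/
lemma exists_state_functional {φ : ℝ → ℂ}
    (hφ : MemLp φ 2 ((volume : Measure ℝ).restrict (Ioo 0 Real.pi))) :
    ∃ ℓ : StateSpace →L[ℂ] ℂ, ∀ z, ℓ z = ∫ x in Ioo 0 Real.pi, z x * φ x := by
  refine ⟨innerSL ℂ (hφ.star.toLp (star φ)), fun z => ?_⟩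
  rw [innerSL_apply_apply, L2.inner_def]
  refine integral_congr_ae ?_
  filter_upwards [hφ.star.coeFn_toLp] with x hx
  rw [hx]
  simp

lemma memLp_Ioo_of_continuous {φ : ℝ → ℂ} (hφ : Continuous φ) :
    MemLp φ 2 ((volume : Measure ℝ).restrict (Ioo 0 Real.pi)) := by
  obtain ⟨C, hC⟩ := isCompact_Icc.exists_bound_of_continuousOn (s := Icc 0 Real.pi) hφ.continuousOn
  refine MemLp.of_bound hφ.aestronglyMeasurable C ?_
  filter_upwards [ae_restrict_mem measurableSet_Ioo] with x hx
  exact hC x (Ioo_subset_Icc_self hx)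

lemma intervalIntegrable_of_integrableOn_Ioo {f : ℝ → ℂ} (hf : IntegrableOn f (Ioo 0 Real.pi)) :
    IntervalIntegrable f volume 0 Real.pi := by
  rw [intervalIntegrable_iff_integrableOn_Ioc_of_le Real.pi_pos.le]
  exact (integrableOn_Ioc_iff_integrableOn_Ioo).2 hf

lemma integral_Ioo_eq_intervalIntegral (f : ℝ → ℂ) :
    ∫ x in Ioo 0 Real.pi, f x = ∫ x in (0 : ℝ)..Real.pi, f x := by
  rw [intervalIntegral.integral_of_le Real.pi_pos.le, integral_Ioc_eq_integral_Ioo]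

lemma isNeumannDomain_cos (m : ℕ) :
    IsNeumannDomain (fun x => (Real.cos (m * x) : ℂ)) (fun x => ((-(m * Real.sin (m * x)) : ℝ) : ℂ))
      (fun x => -(m : ℂ) ^ 2 * Real.cos (m * x)) where
  memLp := memLp_Ioo_of_continuous (by fun_prop)
  deriv_eq x _ := by
    refine eq_primitive_of_hasDerivAt (F := fun x => ((-(m * Real.sin (m * x)) : ℝ) : ℂ))
      (fun x => ?_) (by fun_prop) x
    have h1 : HasDerivAt (fun x : ℝ => (m : ℝ) * x) m x := by
      simpa using (hasDerivAt_id x).const_mul (m : ℝ)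
    exact ((h1.sin.const_mul (m : ℝ)).neg).ofReal_comp.congr_deriv (by push_cast; ring)
  eq x _ := by
    refine eq_primitive_of_hasDerivAt (F := fun x => (Real.cos (m * x) : ℂ))
      (fun x => ?_) (by fun_prop) x
    have h1 : HasDerivAt (fun x : ℝ => (m : ℝ) * x) m x := by
      simpa using (hasDerivAt_id x).const_mul (m : ℝ)
    exact h1.cos.ofReal_comp.congr_deriv (by push_cast; ring)
  deriv_zero := by simp
  deriv_pi := by simp

lemma StateSpace.integrableOn (z : StateSpace) : IntegrableOn (fun x => z x) (Ioo 0 Real.pi) :=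
  (Lp.memLp z).integrable (by norm_num)

lemma StateSpace.eq_of_integral_cos_eq {z z' : StateSpace}
    (h : ∀ m : ℕ, ∫ x in Ioo 0 Real.pi, z x * Real.cos (m * x) =
      ∫ x in Ioo 0 Real.pi, z' x * Real.cos (m * x)) : z = z' := by
  have key := ae_eq_zero_of_integral_cos_eq_zero
    (z.integrableOn.sub z'.integrableOn) (fun m => by
      simp only [Pi.sub_apply, sub_mul]
      rw [integral_sub (integrableOn_mul_of_continuous z.integrableOn (by fun_prop))
        (integrableOn_mul_of_continuous z'.integrableOn (by fun_prop)), h m, sub_self])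
  apply Lp.ext
  filter_upwards [key] with x hx
  exact sub_eq_zero.1 hx

/-- The boundary terms cancel in the difference, whose m-th cosine coefficient satisfies y = -m² ∫ y
and hence vanishes; completeness of the cosines concludes. -/
theorem IsNeumannSolution.eqOn {τ : ℝ} {u : InputSpace τ} {z z' : ℝ → StateSpace}
    (hz : IsNeumannSolution τ u z) (hz' : IsNeumannSolution τ u z') : EqOn z' z (Icc 0 τ) := by
  intro t ht
  refine StateSpace.eq_of_integral_cos_eq fun m => ?_
  obtain ⟨ℓ, hℓ⟩ := exists_state_functional (φ := fun x => (Real.cos (m * x) : ℂ))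
    (memLp_Ioo_of_continuous (by fun_prop))
  have hcont : ContinuousOn (fun t => ℓ (z' t) - ℓ (z t)) (Icc 0 τ) :=
    (ℓ.continuous.comp_continuousOn hz'.continuousOn).sub
      (ℓ.continuous.comp_continuousOn hz.continuousOn)
  have h0 := eq_zero_of_eq_mul_integral (c := -(m : ℂ) ^ 2) hcont (fun t ht => by
    have hsub : uIcc 0 t ⊆ Icc 0 τ := by rw [uIcc_of_le ht.1]; exact Icc_subset_Icc_right ht.2
    have e1 := hz.equation _ _ _ (isNeumannDomain_cos m) t ht
    have e2 := hz'.equation _ _ _ (isNeumannDomain_cos m) t ht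
    have e : ∀ y : ℝ → StateSpace, ∀ s, ∫ x in Ioo 0 Real.pi,
        y s x * (-(m : ℂ) ^ 2 * Real.cos (m * x)) = -(m : ℂ) ^ 2 * ℓ (y s) := fun y s => by
      rw [hℓ, ← integral_const_mul]
      congr 1; ext x; ring
    simp_rw [e, ← hℓ] at e1 e2
    rw [intervalIntegral.integral_const_mul] at e1 e2
    have i1 : IntervalIntegrable (fun s => ℓ (z' s)) volume 0 t :=
      ((ℓ.continuous.comp_continuousOn hz'.continuousOn).mono hsub).intervalIntegrable
    have i2 : IntervalIntegrable (fun s => ℓ (z s)) volume 0 t :=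
      ((ℓ.continuous.comp_continuousOn hz.continuousOn).mono hsub).intervalIntegrable
    rw [e1, e2, intervalIntegral.integral_sub i1 i2]
    ring) t ht
  rw [← hℓ, ← hℓ]
  exact sub_eq_zero.1 h0

lemma integral_cos_int_mul (k : ℤ) :
    ∫ x in (0 : ℝ)..Real.pi, ((Real.cos (k * x) : ℝ) : ℂ) = if k = 0 then (Real.pi : ℂ) else 0 := by
  rw [intervalIntegral.integral_ofReal]
  split_ifs with hk
  · simp [hk]
  · have hk' : (k : ℝ) ≠ 0 := by exact_mod_cast hk
    rw [intervalIntegral.integral_comp_mul_left (fun y => Real.cos y) hk', integral_cos]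
    simp

/-- It suffices to test the weak equation with cosines. -/
lemma weak_equation_of_cos {ζ Z : ℝ → ℂ} {U₀ U₁ : ℂ} (hζ : IntegrableOn ζ (Ioo 0 Real.pi))
    (hZ : IntegrableOn Z (Ioo 0 Real.pi))
    (h : ∀ m : ℕ, ∫ x in Ioo 0 Real.pi, ζ x * Real.cos (m * x) =
      (∫ x in Ioo 0 Real.pi, Z x * (-(m : ℂ) ^ 2 * Real.cos (m * x))) +
        (U₁ * Real.cos (m * Real.pi) - U₀))
    {φ φ₁ φ₂ : ℝ → ℂ} (hφ : IsNeumannDomain φ φ₁ φ₂) :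
    ∫ x in Ioo 0 Real.pi, ζ x * φ x =
      (∫ x in Ioo 0 Real.pi, Z x * φ₂ x) + (U₁ * φ Real.pi - U₀ * φ 0) := by
  have hpi := Real.pi_pos.le
  have hζi := intervalIntegrable_of_integrableOn_Ioo hζ
  have hprim : ∀ {f : ℝ → ℂ}, IntervalIntegrable f volume 0 Real.pi →
      ContinuousOn (fun y => ∫ x in (0 : ℝ)..y, f x) (uIcc 0 Real.pi) := fun {f} hf =>
    intervalIntegral.continuousOn_primitive_interval
      (by rw [uIcc_of_le hpi]; exact (intervalIntegrable_iff_integrableOn_Icc_of_le hpi).1 hf)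
  -- W solves W'' = ζ with W'(0) = U₀; the test with m = 0 is the compatibility condition giving
  -- W'(π) = U₁. Two integrations by parts show that W satisfies the desired identity in place of Z,
  -- for every test function.
  set W₁ : ℝ → ℂ := fun x => U₀ + ∫ y in (0 : ℝ)..x, ζ y with hW₁
  set W : ℝ → ℂ := fun x => ∫ y in (0 : ℝ)..x, W₁ y with hW
  have hW₁i : IntervalIntegrable W₁ volume 0 Real.pi :=
    (continuousOn_const.add (hprim hζi)).intervalIntegrable
  have hW₁pi : W₁ Real.pi = U₁ := by
    have h0 := h 0
    simp only [Nat.cast_zero, zero_mul, Real.cos_zero, Complex.ofReal_one, mul_one, ne_eq,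
      OfNat.ofNat_ne_zero, not_false_eq_true, zero_pow, neg_zero, mul_zero, integral_zero,
      zero_add] at h0
    rw [hW₁]
    simp only
    rw [← integral_Ioo_eq_intervalIntegral, h0]
    ring
  have hibp : ∀ {φ φ₁ φ₂ : ℝ → ℂ}, IsNeumannDomain φ φ₁ φ₂ →
      ∫ x in (0 : ℝ)..Real.pi, W x * φ₂ x =
        (∫ x in Ioo 0 Real.pi, ζ x * φ x) - (U₁ * φ Real.pi - U₀ * φ 0) := by
    intro φ φ₁ φ₂ hφ
    have hφ₂i : IntervalIntegrable φ₂ volume 0 Real.pi :=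
      intervalIntegrable_of_integrableOn_Ioo (hφ.memLp.integrable (by norm_num))
    have hφ₁i : IntervalIntegrable φ₁ volume 0 Real.pi := by
      refine ContinuousOn.intervalIntegrable
        ((continuousOn_const.add (hprim hφ₂i)).congr fun x hx => hφ.deriv_eq x ?_)
      rwa [uIcc_of_le hpi] at hx
    have s1 := integral_mul_eq_of_primitive hpi (F := W) hW₁i hφ₂i
      (fun x _ => by simp [hW]) hφ.deriv_eq
    have s2 := integral_mul_eq_of_primitive hpi (F := W₁) hζi hφ₁i
      (fun x _ => by simp [hW₁]) hφ.eq
    rw [s1, s2, hφ.deriv_pi, hφ.deriv_zero, hW₁pi, integral_Ioo_eq_intervalIntegral]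
    have : W₁ 0 = U₀ := by simp [hW₁]
    rw [this]; ring
  have hWc : ContinuousOn W (uIcc 0 Real.pi) := hprim hW₁i
  have hWint : IntegrableOn W (Ioo 0 Real.pi) :=
    ((intervalIntegrable_iff_integrableOn_Ioc_of_le hpi).1 hWc.intervalIntegrable).mono_set
      Ioo_subset_Ioc_self
  -- The cosine tests determine Z - W up to its mean κ, since the factor -m² vanishes only at m = 0.
  -- The constant is harmless because ∫ φ₂ = φ₁(π) - φ₁(0) = 0.
  set κ : ℂ := (Real.pi : ℂ)⁻¹ * ∫ x in Ioo 0 Real.pi, (Z x - W x) with hκ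
  have hconst : IntegrableOn (fun _ : ℝ => κ) (Ioo 0 Real.pi) :=
    integrableOn_const (by simp)
  have hpi' : (Real.pi : ℂ) ≠ 0 := by exact_mod_cast Real.pi_ne_zero
  have hae := ae_eq_zero_of_integral_cos_eq_zero (f := fun x => Z x - W x - κ)
    ((hZ.sub hWint).sub hconst) (fun m => by
      have hcos : Continuous fun x : ℝ => (Real.cos (m * x) : ℂ) := by fun_prop
      have e : ∫ x in Ioo 0 Real.pi, (Z x - W x - κ) * Real.cos (m * x) =
          (∫ x in Ioo 0 Real.pi, Z x * Real.cos (m * x)) -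
          (∫ x in Ioo 0 Real.pi, W x * Real.cos (m * x)) -
          κ * ∫ x in Ioo 0 Real.pi, (Real.cos (m * x) : ℂ) := by
        simp only [sub_mul]
        rw [integral_sub, integral_sub, integral_const_mul]
        · exact integrableOn_mul_of_continuous hZ hcos
        · exact integrableOn_mul_of_continuous hWint hcos
        · exact (integrableOn_mul_of_continuous hZ hcos).sub
            (integrableOn_mul_of_continuous hWint hcos)
        · exact integrableOn_mul_of_continuous hconst hcos
      have hc := integral_cos_int_mul m
      rw [← integral_Ioo_eq_intervalIntegral] at hc
      push_cast at hc e ⊢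
      rw [e, hc]
      rcases Nat.eq_zero_or_pos m with rfl | hm
      · simp only [Nat.cast_zero, zero_mul, Complex.cos_zero, mul_one, if_true]
        rw [← integral_sub hZ hWint, hκ]
        field_simp
        ring
      · have hm' : (m : ℂ) ≠ 0 := by exact_mod_cast hm.ne'
        have w1 := hibp (isNeumannDomain_cos m)
        have w2 := h m
        rw [← integral_Ioo_eq_intervalIntegral] at w1
        have c1 : ∀ f : ℝ → ℂ, ∫ x in Ioo 0 Real.pi, f x * (-(m : ℂ) ^ 2 * Real.cos (m * x)) =
            -(m : ℂ) ^ 2 * ∫ x in Ioo 0 Real.pi, f x * Real.cos (m * x) := fun f => by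
          rw [← integral_const_mul]; congr 1; ext x; ring
        rw [c1] at w1 w2
        simp only [mul_zero, Real.cos_zero, Complex.ofReal_one, mul_one] at w1
        push_cast at w1 w2
        have hm0 : (m : ℤ) ≠ 0 := by exact_mod_cast hm.ne'
        rw [if_neg hm0, mul_zero, sub_zero]
        have : -(m : ℂ) ^ 2 * ((∫ x in Ioo 0 Real.pi, Z x * Complex.cos (m * x)) -
          ∫ x in Ioo 0 Real.pi, W x * Complex.cos (m * x)) = 0 := by
          rw [mul_sub, w1, w2]; ring
        exact (mul_eq_zero.1 this).resolve_left (neg_ne_zero.2 (pow_ne_zero 2 hm')))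
  have hφ₂i : IntervalIntegrable φ₂ volume 0 Real.pi :=
    intervalIntegrable_of_integrableOn_Ioo (hφ.memLp.integrable (by norm_num))
  have hφ₂0 : ∫ x in (0 : ℝ)..Real.pi, φ₂ x = 0 := by
    have := hφ.deriv_eq Real.pi ⟨hpi, le_rfl⟩
    rw [hφ.deriv_pi, hφ.deriv_zero, zero_add] at this
    exact this.symm
  have hfin : ∫ x in Ioo 0 Real.pi, Z x * φ₂ x = ∫ x in (0 : ℝ)..Real.pi, W x * φ₂ x := by
    have e : ∫ x in Ioo 0 Real.pi, Z x * φ₂ x = ∫ x in Ioo 0 Real.pi, (W x * φ₂ x + κ * φ₂ x) := by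
      refine integral_congr_ae ?_
      filter_upwards [hae] with x hx
      have : Z x = W x + κ := by linear_combination hx
      simp only [this, add_mul]
    rw [e, integral_Ioo_eq_intervalIntegral, intervalIntegral.integral_add
      (hφ₂i.continuousOn_mul hWc) (hφ₂i.const_mul κ), intervalIntegral.integral_const_mul, hφ₂0,
      mul_zero, add_zero]
  rw [hfin, hibp hφ]
  ring

/-! ## Cosine coefficients of the kernel -/

/-- Average the exponential series with its image under n ↦ -n. -/
lemma hasSum_heatKernel_cos {t : ℝ} (ht : 0 < t) (x : ℝ) :
    HasSum (fun n : ℤ => (Real.pi : ℂ)⁻¹ * (Complex.exp (-(n : ℂ) ^ 2 * t) * Real.cos (n * x)))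
      (heatKernel t x) := by
  have h1 := hasSum_heatKernel ht (x : ℂ)
  have h2 := (Equiv.neg ℤ).hasSum_iff.2 h1
  have h3 := (h1.add h2).mul_left (2⁻¹ : ℂ)
  rw [← two_mul, inv_mul_cancel_left₀ two_ne_zero] at h3
  refine h3.congr_fun fun n => ?_
  simp only [Function.comp_apply, Equiv.neg_apply, Complex.exp_add]
  push_cast
  rw [Complex.cos]
  have e1 : Complex.exp (Complex.I * n * x) = Complex.exp (n * x * Complex.I) := by congr 1; ring
  have e2 : Complex.exp (Complex.I * -n * x) = Complex.exp (-(n * x) * Complex.I) := by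
    congr 1; ring
  rw [e1, e2, neg_sq]
  ring

lemma integral_cos_mul_cos (n : ℤ) (m : ℕ) :
    ∫ x in Ioo 0 Real.pi, (Real.cos (n * x) : ℂ) * Real.cos (m * x) =
      Real.pi / 2 * ((if n = m then 1 else 0) + if n = -m then 1 else 0) := by
  have e : ∀ x : ℝ, (Real.cos (n * x) : ℂ) * Real.cos (m * x) =
      2⁻¹ * ((Real.cos ((n - m : ℤ) * x) : ℝ) : ℂ) +
      2⁻¹ * ((Real.cos ((n + m : ℤ) * x) : ℝ) : ℂ) := by
    intro x
    have c1 : Real.cos ((n - m : ℤ) * x) = Real.cos (n * x - m * x) := by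
      congr 1; push_cast; ring
    have c2 : Real.cos ((n + m : ℤ) * x) = Real.cos (n * x + m * x) := by
      congr 1; push_cast; ring
    rw [c1, c2, Real.cos_add, Real.cos_sub]
    push_cast; ring
  simp_rw [e]
  rw [integral_Ioo_eq_intervalIntegral, intervalIntegral.integral_add
    (Continuous.intervalIntegrable (by fun_prop) _ _)
    (Continuous.intervalIntegrable (by fun_prop) _ _), intervalIntegral.integral_const_mul,
    intervalIntegral.integral_const_mul, integral_cos_int_mul, integral_cos_int_mul]
  simp only [sub_eq_zero, add_eq_zero_iff_eq_neg]
  split_ifs <;> ring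

/-- Termwise integration, justified by Gaussian summability. The indices n = m and n = -m contribute
one half each; for m = 0 both halves fall on n = 0, so no case distinction is needed. -/
lemma integral_heatKernel_mul_cos {t : ℝ} (ht : 0 < t) (m : ℕ) :
    ∫ x in Ioo 0 Real.pi, heatKernel t x * Real.cos (m * x) =
      Complex.exp (-(m : ℂ) ^ 2 * t) := by
  set F : ℤ → ℝ → ℂ := fun n x =>
    (Real.pi : ℂ)⁻¹ * (Complex.exp (-(n : ℂ) ^ 2 * t) * Real.cos (n * x)) * Real.cos (m * x) with hF
  have hFint : ∀ n, Integrable (F n) ((volume : Measure ℝ).restrict (Ioo 0 Real.pi)) := fun n =>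
    (memLp_Ioo_of_continuous (by fun_prop)).integrable (by norm_num)
  have hexp : ∀ n : ℤ, ‖Complex.exp (-(n : ℂ) ^ 2 * t)‖ = Real.exp (-t * (n : ℝ) ^ 2) := by
    intro n
    have : (-(n : ℂ) ^ 2 * t) = ((-t * (n : ℝ) ^ 2 : ℝ) : ℂ) := by push_cast; ring
    rw [this, ← Complex.ofReal_exp, Complex.norm_real, Real.norm_of_nonneg (Real.exp_pos _).le]
  have hpi := Real.pi_pos
  have hsum : Summable fun n => ∫ x in Ioo 0 Real.pi, ‖F n x‖ := by
    refine Summable.of_nonneg_of_le (fun n => integral_nonneg fun x => norm_nonneg _) (fun n => ?_)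
      (summable_exp_neg_mul_int_sq ht)
    calc ∫ x in Ioo 0 Real.pi, ‖F n x‖
        ≤ ∫ x in Ioo 0 Real.pi, Real.pi⁻¹ * Real.exp (-t * (n : ℝ) ^ 2) := by
          refine integral_mono (hFint n).norm (integrableOn_const (by simp)) fun x => ?_
          simp only [hF]
          rw [norm_mul, norm_mul, norm_mul, hexp, norm_inv, Complex.norm_real, Complex.norm_real,
            Complex.norm_real, Real.norm_of_nonneg hpi.le]
          have c1 := Real.abs_cos_le_one (n * x)
          have c2 := Real.abs_cos_le_one (m * x)
          have := Real.exp_pos (-t * (n : ℝ) ^ 2)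
          calc _ ≤ Real.pi⁻¹ * (Real.exp (-t * (n : ℝ) ^ 2) * 1) * 1 := by
                gcongr <;> assumption
            _ = _ := by ring
      _ = Real.exp (-t * (n : ℝ) ^ 2) := by
          rw [integral_const]; simp [hpi.le]
  have hs := hasSum_integral_of_summable_integral_norm hFint hsum
  have hlim : ∀ x : ℝ, ∑' n, F n x = heatKernel t x * Real.cos (m * x) := fun x =>
    ((hasSum_heatKernel_cos ht x).mul_right _).tsum_eq
  simp_rw [hlim] at hs
  refine hs.unique ?_
  have hval : ∀ n : ℤ, ∫ x in Ioo 0 Real.pi, F n x =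
      (if n = m then 2⁻¹ * Complex.exp (-(m : ℂ) ^ 2 * t) else 0) +
        if n = -m then 2⁻¹ * Complex.exp (-(m : ℂ) ^ 2 * t) else 0 := by
    intro n
    have : ∀ x, F n x = (Real.pi : ℂ)⁻¹ * Complex.exp (-(n : ℂ) ^ 2 * t) *
        ((Real.cos (n * x) : ℂ) * Real.cos (m * x)) := fun x => by simp only [hF]; ring
    have hpi' : (Real.pi : ℂ) ≠ 0 := by exact_mod_cast hpi.ne'
    simp_rw [this]
    rw [integral_const_mul, integral_cos_mul_cos]
    split_ifs with h1 h2 h2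
    · rw [h1]; push_cast; field_simp
    · rw [h1]; push_cast; field_simp; ring
    · rw [h2]; push_cast; field_simp; simp
    · simp
  simp_rw [hval]
  have := (hasSum_ite_eq (m : ℤ) (2⁻¹ * Complex.exp (-(m : ℂ) ^ 2 * t))).add
    (hasSum_ite_eq (-m : ℤ) (2⁻¹ * Complex.exp (-(m : ℂ) ^ 2 * t)))
  rwa [← add_mul, show (2⁻¹ + 2⁻¹ : ℂ) = 1 by norm_num, one_mul] at this

lemma integral_heatKernel_reflect_mul_cos {t : ℝ} (ht : 0 < t) (m : ℕ) :
    ∫ x in Ioo 0 Real.pi, heatKernel t (Real.pi - x) * Real.cos (m * x) =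
      Real.cos (m * Real.pi) * Complex.exp (-(m : ℂ) ^ 2 * t) := by
  have h := intervalIntegral.integral_comp_sub_left (a := 0) (b := Real.pi)
    (fun x : ℝ => heatKernel t x * Real.cos (m * (Real.pi - x))) Real.pi
  rw [sub_self, sub_zero] at h
  rw [integral_Ioo_eq_intervalIntegral]
  have e1 : ∀ x : ℝ, heatKernel t (Real.pi - x) * Real.cos (m * x) =
      heatKernel t ((Real.pi - x : ℝ) : ℂ) * Real.cos (m * (Real.pi - (Real.pi - x))) := by
    intro x; rw [sub_sub_cancel]; push_cast; rfl
  simp_rw [e1]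
  rw [h, ← integral_heatKernel_mul_cos ht m, ← integral_const_mul, integral_Ioo_eq_intervalIntegral]
  congr 1
  ext x
  have : Real.cos (m * (Real.pi - x)) = Real.cos (m * Real.pi) * Real.cos (m * x) := by
    rw [mul_sub, Real.cos_sub, Real.sin_nat_mul_pi]; ring
  rw [this]; push_cast; ring

/-! ## Existence of the solution -/

/-- The value at time `t` of the solution with input `u`, as a function on `(0, π)`. -/
def mildSolution (τ : ℝ) (u : InputSpace τ) (t x : ℝ) : ℂ :=
  ∫ σ in Icc 0 τ, dotPair (boundaryKernel (t - σ) x) (u σ)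

lemma exists_norm_boundaryKernel_ofReal_le {τ a : ℝ} (hτ : 0 < τ) (ha : 0 < a) :
    ∃ C : ℝ, 0 ≤ C ∧ ∀ t : ℝ, 0 < t → t ≤ τ → ∀ x ∈ Ioo 0 Real.pi,
      ‖boundaryKernel t (x : ℂ)‖ ≤
        C * t ^ (a - 1 / 2) * (x ^ (-(2 * a)) + (Real.pi - x) ^ (-(2 * a))) := by
  obtain ⟨C, hC0, hC⟩ := exists_norm_boundaryKernel_le le_rfl zero_lt_one hτ ha
  refine ⟨C, hC0, fun t h0 h1 x hx => ?_⟩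
  simpa using (hC t h0 h1 (x : ℂ) (by simpa using hx.1) (by simpa using hx.2) (by simp)).1

/-- At an interior point x the kernel tends to its default value 0 as r ↓ 0, by the bound of order
r^(1/2) from a = 1. The time integral can therefore always run over [0, τ], with t entering only
through the integrand. -/
lemma continuous_boundaryKernel_time {x : ℝ} (hx : x ∈ Ioo 0 Real.pi) :
    Continuous fun r : ℝ => boundaryKernel r (x : ℂ) := by
  rw [continuous_iff_continuousAt]
  intro r
  rcases lt_trichotomy r 0 with hr | rfl | hr
  · have : (fun r : ℝ => boundaryKernel r (x : ℂ)) =ᶠ[nhds r] fun _ => 0 := by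
      filter_upwards [Iio_mem_nhds hr] with r' hr'
      exact boundaryKernel_of_nonpos (le_of_lt hr') _
    exact continuousAt_const.congr this.symm
  · obtain ⟨C, hC0, hC⟩ := exists_norm_boundaryKernel_ofReal_le (τ := 1) (a := 1) one_pos one_pos
    set P := x ^ (-(2 * 1) : ℝ) + (Real.pi - x) ^ (-(2 * 1) : ℝ) with hP
    have hP0 : 0 ≤ P := by
      have := hx.1.le; have : 0 ≤ Real.pi - x := by linarith [hx.2]
      positivity
    rw [ContinuousAt, boundaryKernel_of_nonpos le_rfl]
    refine squeeze_zero_norm' (a := fun r : ℝ => C * |r| ^ (1 / 2 : ℝ) * P) ?_ ?_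
    · filter_upwards [Iio_mem_nhds (zero_lt_one (α := ℝ))] with r hr
      rcases le_or_gt r 0 with h | h
      · rw [boundaryKernel_of_nonpos h, norm_zero]; positivity
      · have := hC r h (le_of_lt hr) x hx
        rw [abs_of_pos h]
        convert this using 4
        norm_num
    · have : Continuous fun r : ℝ => C * |r| ^ (1 / 2 : ℝ) * P := by
        have : Continuous fun r : ℝ => |r| ^ (1 / 2 : ℝ) :=
          continuous_abs.rpow_const fun _ => Or.inr (by norm_num)
        fun_prop
      have h := this.tendsto 0
      simpa using h
  · have h : ∀ s : ℂ, ContinuousAt (fun r : ℝ => heatKernel r s) r := fun s =>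
      ContinuousAt.comp_of_eq (g := fun p : ℝ × ℂ => heatKernel p.1 p.2)
        (f := fun r : ℝ => (r, s)) (continuousAt_heatKernel hr s) (by fun_prop) rfl
    refine (PiLp.continuous_toLp 2 _).continuousAt.comp (continuousAt_pi.2 ?_)
    exact Fin.forall_fin_two.2 ⟨(h x).neg, h (Real.pi - x)⟩

lemma continuous_heatKernel (t : ℝ) : Continuous (heatKernel t) :=
  continuous_iff_continuousAt.2 fun s => (hasDerivAt_heatKernel t s).continuousAt

lemma integral_boundaryKernel_mul_cos {r : ℝ} (hr : 0 < r) (y : EuclideanSpace ℂ (Fin 2)) (m : ℕ) :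
    ∫ x in Ioo 0 Real.pi, dotPair (boundaryKernel r (x : ℂ)) y * Real.cos (m * x) =
      Complex.exp (-(m : ℂ) ^ 2 * r) * (Real.cos (m * Real.pi) * y 1 - y 0) := by
  have e : ∀ x : ℝ, dotPair (boundaryKernel r (x : ℂ)) y * Real.cos (m * x) =
      y 1 * (heatKernel r (Real.pi - x) * Real.cos (m * x)) -
        y 0 * (heatKernel r x * Real.cos (m * x)) := by
    intro x; simp only [dotPair, boundaryKernel, PiLp.toLp_apply, Matrix.cons_val_zero,
      Matrix.cons_val_one]; ring
  have hc := continuous_heatKernel r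
  simp_rw [e]
  rw [integral_sub, integral_const_mul, integral_const_mul, integral_heatKernel_mul_cos hr,
    integral_heatKernel_reflect_mul_cos hr]
  · ring
  · exact (memLp_Ioo_of_continuous (by fun_prop)).integrable (by norm_num)
  · exact (memLp_Ioo_of_continuous (by fun_prop)).integrable (by norm_num)

/-- The singular weight in time. -/
def timeWeight (t σ : ℝ) : ℝ := (Iio t).indicator (fun σ => (t - σ) ^ (-(3 / 8) : ℝ)) σ

lemma timeWeight_nonneg (t σ : ℝ) : 0 ≤ timeWeight t σ := by
  refine indicator_nonneg (fun σ hσ => ?_) σ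
  exact Real.rpow_nonneg (sub_nonneg.2 (le_of_lt hσ)) _

lemma memLp_timeWeight {τ t : ℝ} (ht : t ∈ Icc 0 τ) :
    MemLp (timeWeight t) 2 ((volume : Measure ℝ).restrict (Icc 0 τ)) := by
  unfold timeWeight
  rw [memLp_indicator_iff_restrict measurableSet_Iio, Measure.restrict_restrict measurableSet_Iio]
  rcases ht.1.eq_or_lt with h | h
  · have : Iio t ∩ Icc 0 τ = ∅ := by
      ext σ; simp only [mem_inter_iff, mem_Iio, mem_Icc, mem_empty_iff_false, iff_false]
      intro h'; linarith [h'.1, h'.2.1]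
    rw [this, Measure.restrict_empty]
    simp
  · refine (memLp_two_sub_rpow h (by norm_num)).mono_measure (Measure.restrict_mono_set _ ?_)
    exact fun σ hσ => ⟨hσ.2.1, le_of_lt hσ.1⟩

/-- Substituting r = t - σ and enlarging [0, t] to [0, τ] makes the bound uniform in t. -/
lemma integral_timeWeight_sq_le {τ t : ℝ} (ht : t ∈ Icc 0 τ) :
    ∫ σ in Icc 0 τ, timeWeight t σ ^ 2 ≤ ∫ r in (0 : ℝ)..τ, (r ^ (-(3 / 8) : ℝ)) ^ 2 := by
  have h1 : ∀ σ, timeWeight t σ ^ 2 =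
      (Iio t).indicator (fun σ => ((t - σ) ^ (-(3 / 8) : ℝ)) ^ 2) σ := by
    intro σ
    by_cases h : σ < t <;> simp [timeWeight, indicator, h]
  have h2 : Iio t ∩ Icc 0 τ = Ico 0 t := by
    ext σ; simp only [mem_inter_iff, mem_Iio, mem_Icc, mem_Ico]
    exact ⟨fun h => ⟨h.2.1, h.1⟩, fun h => ⟨h.2, h.1, h.2.le.trans ht.2⟩⟩
  simp_rw [h1]
  rw [integral_indicator measurableSet_Iio, Measure.restrict_restrict measurableSet_Iio, h2,
    integral_Ico_eq_integral_Ioc, ← intervalIntegral.integral_of_le ht.1,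
    intervalIntegral.integral_comp_sub_left (fun r => (r ^ (-(3 / 8) : ℝ)) ^ 2) t, sub_self,
    sub_zero]
  refine intervalIntegral.integral_mono_interval le_rfl ht.1 ht.2
    (Filter.Eventually.of_forall fun r => sq_nonneg _) ?_
  have h : IntervalIntegrable (fun σ : ℝ => σ ^ (-(3 / 4) : ℝ)) volume 0 τ :=
    intervalIntegral.intervalIntegrable_rpow' (by norm_num)
  refine h.congr fun r hr => ?_
  rw [uIoc_of_le (ht.1.trans ht.2)] at hr
  rw [← Real.rpow_natCast, ← Real.rpow_mul hr.1.le]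
  norm_num

/-- The singular weight in space. -/
def spaceWeight (x : ℝ) : ℝ := x ^ (-(1 / 4) : ℝ) + (Real.pi - x) ^ (-(1 / 4) : ℝ)

lemma spaceWeight_nonneg {x : ℝ} (hx : x ∈ Ioo 0 Real.pi) : 0 ≤ spaceWeight x :=
  add_nonneg (Real.rpow_nonneg hx.1.le _) (Real.rpow_nonneg (sub_nonneg.2 hx.2.le) _)

lemma memLp_spaceWeight :
    MemLp spaceWeight 2 ((volume : Measure ℝ).restrict (Ioo 0 Real.pi)) := by
  refine MemLp.add ?_ ((memLp_two_sub_rpow Real.pi_pos (by norm_num)).mono_measure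
    (Measure.restrict_mono_set _ Ioo_subset_Icc_self))
  have hm : Measurable fun x : ℝ => x ^ (-(1 / 4) : ℝ) := by fun_prop
  rw [memLp_two_iff_integrable_sq hm.aestronglyMeasurable]
  have h := (intervalIntegral.integrableOn_Ioo_rpow_iff (s := -(1 / 2)) Real.pi_pos).2 (by norm_num)
  refine h.congr_fun (fun x hx => ?_) measurableSet_Ioo
  simp only
  rw [← Real.rpow_natCast, ← Real.rpow_mul hx.1.le]
  norm_num

/-- The choice a = 1/8 gives the exponents a - 1/2 = -3/8 in time and -2a = -1/4 in space, both
square integrable. -/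
lemma exists_norm_boundaryKernel_le_weights {τ : ℝ} (hτ : 0 < τ) :
    ∃ C : ℝ, 0 ≤ C ∧ ∀ t ∈ Icc 0 τ, ∀ σ ∈ Icc 0 τ, ∀ x ∈ Ioo 0 Real.pi,
      ‖boundaryKernel (t - σ) (x : ℂ)‖ ≤ C * spaceWeight x * timeWeight t σ := by
  obtain ⟨C, hC0, hC⟩ := exists_norm_boundaryKernel_ofReal_le (a := 1 / 8) hτ (by norm_num)
  refine ⟨C, hC0, fun t ht σ hσ x hx => ?_⟩
  rcases le_or_gt t σ with h | h
  · rw [boundaryKernel_of_nonpos (by linarith), norm_zero]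
    exact mul_nonneg (mul_nonneg hC0 (spaceWeight_nonneg hx)) (timeWeight_nonneg _ _)
  · have := hC (t - σ) (by linarith) (by linarith [ht.2, hσ.1]) x hx
    rw [timeWeight, indicator_of_mem (show σ ∈ Iio t from h), spaceWeight]
    convert this using 1
    norm_num
    ring

lemma stronglyMeasurable_dotPair_boundaryKernel {τ : ℝ} (u : InputSpace τ) (t : ℝ) :
    StronglyMeasurable fun p : ℝ × ℝ => dotPair (boundaryKernel (t - p.2) p.1) (u p.2) := by
  have hu : Measurable fun σ => u σ := (Lp.stronglyMeasurable u).measurable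
  have hk : Measurable fun p : ℝ × ℝ => boundaryKernel (t - p.2) p.1 :=
    measurable_boundaryKernel.comp (g := fun p : ℝ × ℂ => boundaryKernel p.1 p.2)
      (f := fun p : ℝ × ℝ => (t - p.2, (p.1 : ℂ))) (by fun_prop)
  have hcoord : ∀ i : Fin 2, Measurable fun x : EuclideanSpace ℂ (Fin 2) => x i := fun i =>
    (PiLp.continuous_apply 2 _ i).measurable
  have hu' : Measurable fun p : ℝ × ℝ => u p.2 := hu.comp measurable_snd
  exact ((((hcoord 0).comp hk).mul ((hcoord 0).comp hu')).add
    (((hcoord 1).comp hk).mul ((hcoord 1).comp hu'))).stronglyMeasurable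

lemma integrable_norm_input {τ : ℝ} (u : InputSpace τ) :
    Integrable (fun σ => ‖u σ‖) ((volume : Measure ℝ).restrict (Icc 0 τ)) :=
  ((Lp.memLp u).integrable (by norm_num)).norm

lemma integrable_timeWeight_mul_norm {τ t : ℝ} (u : InputSpace τ) (ht : t ∈ Icc 0 τ) :
    Integrable (fun σ => timeWeight t σ * ‖u σ‖) ((volume : Measure ℝ).restrict (Icc 0 τ)) :=
  (memLp_timeWeight ht).integrable_mul (Lp.memLp u).norm

/-- The majorant does not depend on t and is in L² in x, so it dominates in the proof of continuity
in time. The time integral is split by 2ab ≤ a² + b². -/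
lemma exists_norm_mildSolution_le {τ : ℝ} (hτ : 0 < τ) (u : InputSpace τ) :
    ∃ D : ℝ, 0 ≤ D ∧ ∀ t ∈ Icc 0 τ, ∀ x ∈ Ioo 0 Real.pi,
      ‖mildSolution τ u t x‖ ≤ D * spaceWeight x := by
  obtain ⟨C, hC0, hC⟩ := exists_norm_boundaryKernel_le_weights hτ
  set M := ∫ r in (0 : ℝ)..τ, (r ^ (-(3 / 8) : ℝ)) ^ 2 with hM
  set N := ∫ σ in Icc 0 τ, ‖u σ‖ ^ 2 with hN
  have hM0 : 0 ≤ M := intervalIntegral.integral_nonneg hτ.le fun _ _ => sq_nonneg _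
  have hN0 : 0 ≤ N := integral_nonneg fun _ => sq_nonneg _
  refine ⟨C * ((M + N) / 2), by positivity, fun t ht x hx => ?_⟩
  have hP := spaceWeight_nonneg hx
  have hu2 : Integrable (fun σ => ‖u σ‖ ^ 2) ((volume : Measure ℝ).restrict (Icc 0 τ)) :=
    (Lp.memLp u).norm.integrable_sq
  have hw2 := (memLp_timeWeight ht).integrable_sq
  calc ‖mildSolution τ u t x‖
      ≤ ∫ σ in Icc 0 τ, C * spaceWeight x * ((timeWeight t σ ^ 2 + ‖u σ‖ ^ 2) / 2) := by
        refine norm_integral_le_of_norm_le (((hw2.add hu2).div_const 2).const_mul _) ?_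
        filter_upwards [ae_restrict_mem measurableSet_Icc] with σ hσ
        refine (norm_dotPair_le _ _).trans ?_
        calc _ ≤ C * spaceWeight x * timeWeight t σ * ‖u σ‖ := by
              gcongr; exact hC t ht σ hσ x hx
          _ = C * spaceWeight x * (timeWeight t σ * ‖u σ‖) := by ring
          _ ≤ _ := by
              gcongr
              nlinarith [sq_nonneg (timeWeight t σ - ‖u σ‖)]
    _ = C * spaceWeight x * (((∫ σ in Icc 0 τ, timeWeight t σ ^ 2) + N) / 2) := by
        rw [integral_const_mul, integral_div, integral_add hw2 hu2]
    _ ≤ C * spaceWeight x * ((M + N) / 2) := by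
        gcongr
        exact integral_timeWeight_sq_le ht
    _ = _ := by ring

lemma memLp_mildSolution {τ t : ℝ} (hτ : 0 < τ) (u : InputSpace τ) (ht : t ∈ Icc 0 τ) :
    MemLp (mildSolution τ u t) 2 ((volume : Measure ℝ).restrict (Ioo 0 Real.pi)) := by
  obtain ⟨D, hD0, hD⟩ := exists_norm_mildSolution_le hτ u
  refine memLp_spaceWeight.of_le_mul (c := D)
    ((stronglyMeasurable_dotPair_boundaryKernel u t).integral_prod_right').aestronglyMeasurable ?_
  filter_upwards [ae_restrict_mem measurableSet_Ioo] with x hx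
  rw [Real.norm_of_nonneg (spaceWeight_nonneg hx)]
  exact hD t ht x hx

lemma continuousOn_mildSolution {τ x : ℝ} (u : InputSpace τ) (hx : x ∈ Ioo 0 Real.pi) :
    ContinuousOn (fun t => mildSolution τ u t x) (Icc 0 τ) := by
  have hc := continuous_boundaryKernel_time hx
  obtain ⟨C, hC⟩ := isCompact_Icc.exists_bound_of_continuousOn (s := Icc (-τ) τ) hc.continuousOn
  refine continuousOn_of_dominated (bound := fun σ => C * ‖u σ‖) ?_ ?_
    ((integrable_norm_input u).const_mul C) ?_
  · intro t _
    exact ((stronglyMeasurable_dotPair_boundaryKernel u t).comp_measurable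
      (measurable_const.prodMk measurable_id)).aestronglyMeasurable
  · intro t ht
    filter_upwards [ae_restrict_mem measurableSet_Icc] with σ hσ
    refine (norm_dotPair_le _ _).trans ?_
    gcongr
    exact hC _ ⟨by linarith [ht.1, hσ.2], by linarith [ht.2, hσ.1]⟩
  · refine Filter.Eventually.of_forall fun σ => Continuous.continuousOn ?_
    have h : Continuous fun t : ℝ => boundaryKernel (t - σ) (x : ℂ) := by fun_prop
    have hcoord : ∀ i : Fin 2, Continuous fun t : ℝ => boundaryKernel (t - σ) (x : ℂ) i := fun i =>
      (PiLp.continuous_apply 2 _ i).comp h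
    exact ((hcoord 0).mul continuous_const).add ((hcoord 1).mul continuous_const)

/-- Fubini, with the product of the space and time weights as majorant. Vanishing of the kernel for
σ ≥ t cuts the time integral to [0, t]. -/
lemma integral_mildSolution_mul_cos {τ t : ℝ} (hτ : 0 < τ) (u : InputSpace τ) (ht : t ∈ Icc 0 τ)
    (m : ℕ) :
    ∫ x in Ioo 0 Real.pi, mildSolution τ u t x * Real.cos (m * x) =
      ∫ σ in (0 : ℝ)..t, Complex.exp (-(m : ℂ) ^ 2 * (t - σ : ℝ)) *
        (Real.cos (m * Real.pi) * u σ 1 - u σ 0) := by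
  obtain ⟨C, hC0, hC⟩ := exists_norm_boundaryKernel_le_weights hτ
  set μ := (volume : Measure ℝ).restrict (Ioo 0 Real.pi) with hμ
  set ν := (volume : Measure ℝ).restrict (Icc 0 τ) with hν
  have hint : Integrable (fun p : ℝ × ℝ => dotPair (boundaryKernel (t - p.2) p.1) (u p.2) *
      Real.cos (m * p.1)) (μ.prod ν) := by
    have hw : Integrable spaceWeight μ := memLp_spaceWeight.integrable (by norm_num)
    refine ((hw.const_mul C).mul_prod (integrable_timeWeight_mul_norm u ht)).mono' ?_ ?_
    · exact ((stronglyMeasurable_dotPair_boundaryKernel u t).mul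
        (Continuous.stronglyMeasurable (by fun_prop))).aestronglyMeasurable
    · rw [hμ, Measure.prod_restrict]
      filter_upwards [ae_restrict_mem (measurableSet_Ioo.prod measurableSet_Icc)] with p hp
      rw [norm_mul, Complex.norm_real]
      calc _ ≤ ‖boundaryKernel (t - p.2) (p.1 : ℂ)‖ * ‖u p.2‖ * 1 := by
            gcongr
            · exact norm_dotPair_le _ _
            · exact Real.abs_cos_le_one _
        _ ≤ C * spaceWeight p.1 * timeWeight t p.2 * ‖u p.2‖ * 1 := by
            gcongr; exact hC t ht p.2 hp.2 p.1 hp.1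
        _ = _ := by ring
  have hswap := integral_integral_swap
    (f := fun x σ : ℝ => dotPair (boundaryKernel (t - σ) (x : ℂ)) (u σ) * Real.cos (m * x)) hint
  have h1 : ∀ x : ℝ, ∫ σ, dotPair (boundaryKernel (t - σ) (x : ℂ)) (u σ) * Real.cos (m * x) ∂ν =
      mildSolution τ u t x * Real.cos (m * x) := fun x => integral_mul_const _ _
  have h2 : ∀ σ : ℝ, ∫ x, dotPair (boundaryKernel (t - σ) (x : ℂ)) (u σ) * Real.cos (m * x) ∂μ =
      (Iio t).indicator (fun σ => Complex.exp (-(m : ℂ) ^ 2 * (t - σ : ℝ)) *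
        (Real.cos (m * Real.pi) * u σ 1 - u σ 0)) σ := by
    intro σ
    by_cases h : σ < t
    · rw [indicator_of_mem (show σ ∈ Iio t from h)]
      exact integral_boundaryKernel_mul_cos (sub_pos.2 h) (u σ) m
    · rw [indicator_of_notMem (show σ ∉ Iio t from h)]
      have : ∀ x : ℝ, boundaryKernel (t - σ) (x : ℂ) = 0 := fun x =>
        boundaryKernel_of_nonpos (by linarith [not_lt.1 h]) _
      simp [this, dotPair]
  simp_rw [h1, h2] at hswap
  have h3 : Iio t ∩ Icc 0 τ = Ico 0 t := by
    ext σ; simp only [mem_inter_iff, mem_Iio, mem_Icc, mem_Ico]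
    exact ⟨fun h => ⟨h.2.1, h.1⟩, fun h => ⟨h.2, h.1, h.2.le.trans ht.2⟩⟩
  rw [hswap, integral_indicator measurableSet_Iio, hν, Measure.restrict_restrict measurableSet_Iio,
    h3, integral_Ico_eq_integral_Ioc, ← intervalIntegral.integral_of_le ht.1]

/-- The variation of constants formula solves the scalar equation `y' = -c y + g`. -/
lemma duhamel_eq {t : ℝ} (ht : 0 ≤ t) (c : ℂ) {g : ℝ → ℂ} (hg : IntervalIntegrable g volume 0 t) :
    ∫ σ in (0 : ℝ)..t, Complex.exp (-c * (t - σ : ℝ)) * g σ =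
      -c * (∫ s in (0 : ℝ)..t, ∫ σ in (0 : ℝ)..s, Complex.exp (-c * (s - σ : ℝ)) * g σ) +
        ∫ s in (0 : ℝ)..t, g s := by
  -- The inner integral is e^(-cs) P(s), and integrating e^(-cs) by parts against P gives the
  -- formula.
  set P : ℝ → ℂ := fun s => ∫ σ in (0 : ℝ)..s, Complex.exp (c * σ) * g σ with hP
  have hsplit : ∀ s : ℝ, ∫ σ in (0 : ℝ)..s, Complex.exp (-c * (s - σ : ℝ)) * g σ =
      Complex.exp (-c * s) * P s := by
    intro s
    rw [hP, ← intervalIntegral.integral_const_mul]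
    congr 1
    ext σ
    rw [← mul_assoc, ← Complex.exp_add]
    congr 2
    push_cast; ring
  have hexp : Continuous fun x : ℝ => -c * Complex.exp (-c * x) := by fun_prop
  have key := integral_mul_eq_of_primitive ht (F := fun x : ℝ => Complex.exp (-c * x)) (G := P)
    (g := fun σ => Complex.exp (c * σ) * g σ) (hexp.intervalIntegrable _ _)
    (hg.continuousOn_mul (Continuous.continuousOn (by fun_prop)))
    (fun x _ => eq_primitive_of_hasDerivAt (hasDerivAt_cexp_ofReal_mul (-c)) hexp x)
    (fun x _ => by simp [hP])
  have e1 : ∀ x : ℝ, Complex.exp (-c * x) * (Complex.exp (c * x) * g x) = g x := fun x => by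
    rw [← mul_assoc, ← Complex.exp_add]; simp
  have e2 : P 0 = 0 := by simp [hP]
  simp_rw [e1, e2, mul_assoc] at key
  rw [intervalIntegral.integral_const_mul] at key
  simp_rw [hsplit]
  linear_combination -key

/-- Continuity into L² is dominated convergence from pointwise continuity in t. The weak equation is
checked on cosines, where it is Duhamel's formula. -/
theorem exists_isNeumannSolution {τ : ℝ} (hτ : 0 < τ) (u : InputSpace τ) :
    ∃ z : ℝ → StateSpace, IsNeumannSolution τ u z ∧ ∀ t ∈ Icc 0 τ,
      ∀ᵐ x ∂((volume : Measure ℝ).restrict (Ioo 0 Real.pi)), z t x = mildSolution τ u t x := by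
  choose! z hz using fun t (ht : t ∈ Icc 0 τ) => show ∃ z : StateSpace,
      ∀ᵐ x ∂((volume : Measure ℝ).restrict (Ioo 0 Real.pi)), z x = mildSolution τ u t x from
    ⟨(memLp_mildSolution hτ u ht).toLp _, MemLp.coeFn_toLp _⟩
  refine ⟨z, ?_, hz⟩
  have h0 : (0 : ℝ) ∈ Icc 0 τ := ⟨le_rfl, hτ.le⟩
  have hcont : ContinuousOn z (Icc 0 τ) := by
    intro t₀ ht₀
    rw [ContinuousWithinAt, tendsto_iff_norm_sub_tendsto_zero]
    obtain ⟨D, hD0, hD⟩ := exists_norm_mildSolution_le hτ u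
    have hsq : ∀ t ∈ Icc 0 τ, ‖z t - z t₀‖ ^ 2 =
        ∫ x in Ioo 0 Real.pi, ‖mildSolution τ u t x - mildSolution τ u t₀ x‖ ^ 2 := by
      intro t ht
      have hm := (memLp_mildSolution hτ u ht).sub (memLp_mildSolution hτ u ht₀)
      have : z t - z t₀ = hm.toLp _ := by
        apply Lp.ext
        filter_upwards [hm.coeFn_toLp, Lp.coeFn_sub (z t) (z t₀), hz t ht, hz t₀ ht₀]
          with x h1 h2 h3 h4
        rw [h1, h2, Pi.sub_apply, Pi.sub_apply, h3, h4]
      rw [this, hm.norm_toLp_sq]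
      rfl
    have hlim : Filter.Tendsto (fun t => ∫ x in Ioo 0 Real.pi,
        ‖mildSolution τ u t x - mildSolution τ u t₀ x‖ ^ 2) (nhdsWithin t₀ (Icc 0 τ))
        (nhds (∫ x in Ioo 0 Real.pi, (0 : ℝ))) := by
      refine tendsto_integral_filter_of_dominated_convergence
        (fun x => (2 * D) ^ 2 * spaceWeight x ^ 2) ?_ ?_
        (memLp_spaceWeight.integrable_sq.const_mul _) ?_
      · filter_upwards [self_mem_nhdsWithin] with t ht
        exact (((memLp_mildSolution hτ u ht).1.sub
          (memLp_mildSolution hτ u ht₀).1).norm).pow 2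
      · filter_upwards [self_mem_nhdsWithin] with t ht
        filter_upwards [ae_restrict_mem measurableSet_Ioo] with x hx
        rw [Real.norm_of_nonneg (by positivity), ← mul_pow]
        gcongr
        calc _ ≤ ‖mildSolution τ u t x‖ + ‖mildSolution τ u t₀ x‖ := norm_sub_le _ _
          _ ≤ _ := by linarith [hD t ht x hx, hD t₀ ht₀ x hx]
      · filter_upwards [ae_restrict_mem measurableSet_Ioo] with x hx
        have h := continuousOn_mildSolution u hx t₀ ht₀
        have h' := ((tendsto_iff_norm_sub_tendsto_zero.1 h).pow 2)
        simpa using h'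
    rw [integral_zero] at hlim
    have hlim' : Filter.Tendsto (fun t => ‖z t - z t₀‖ ^ 2) (nhdsWithin t₀ (Icc 0 τ)) (nhds 0) :=
      hlim.congr' (by
        filter_upwards [self_mem_nhdsWithin] with t ht
        exact (hsq t ht).symm)
    have := hlim'.sqrt
    simpa [Real.sqrt_sq] using this
  refine ⟨hcont, ?_, ?_⟩
  · apply Lp.ext
    filter_upwards [hz 0 h0, Lp.coeFn_zero ℂ 2 ((volume : Measure ℝ).restrict (Ioo 0 Real.pi))]
      with x h1 h2
    rw [h1, h2, mildSolution, Pi.zero_apply]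
    refine integral_eq_zero_of_ae ?_
    filter_upwards [ae_restrict_mem measurableSet_Icc] with σ hσ
    rw [boundaryKernel_of_nonpos (by linarith [hσ.1])]
    simp [dotPair]
  · intro φ φ₁ φ₂ hφ t ht
    have hsub : uIcc 0 t ⊆ Icc 0 τ := by rw [uIcc_of_le ht.1]; exact Icc_subset_Icc_right ht.2
    have hzi : IntervalIntegrable z volume 0 t := (hcont.mono hsub).intervalIntegrable
    have hui : ∀ i : Fin 2, ∀ s ∈ Icc 0 τ, IntervalIntegrable (fun σ => u σ i) volume 0 s := by
      intro i s hs
      have hu : Integrable (fun σ => u σ) ((volume : Measure ℝ).restrict (Icc 0 τ)) :=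
        (Lp.memLp u).integrable (by norm_num)
      have hui : IntegrableOn (fun σ => u σ i) (Icc 0 τ) :=
        (EuclideanSpace.proj (𝕜 := ℂ) i).integrable_comp hu
      rw [intervalIntegrable_iff_integrableOn_Icc_of_le hs.1]
      exact hui.mono_set (Icc_subset_Icc_right hs.2)
    -- The time integral of z becomes a single state, which plays the role of Z in
    -- `weak_equation_of_cos`.
    have hcomm : ∀ ψ : ℝ → ℂ, MemLp ψ 2 ((volume : Measure ℝ).restrict (Ioo 0 Real.pi)) →
        ∫ x in Ioo 0 Real.pi, (∫ s in (0 : ℝ)..t, z s : StateSpace) x * ψ x =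
          ∫ s in (0 : ℝ)..t, ∫ x in Ioo 0 Real.pi, z s x * ψ x := by
      intro ψ hψ
      obtain ⟨ℓ, hℓ⟩ := exists_state_functional hψ
      simp_rw [← hℓ]
      exact (ℓ.intervalIntegral_comp_comm hzi).symm
    have hcoef : ∀ m : ℕ, ∀ s ∈ Icc 0 τ, ∫ x in Ioo 0 Real.pi, z s x * Real.cos (m * x) =
        ∫ σ in (0 : ℝ)..s, Complex.exp (-(m : ℂ) ^ 2 * (s - σ : ℝ)) *
          (Real.cos (m * Real.pi) * u σ 1 - u σ 0) := by
      intro m s hs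
      rw [← integral_mildSolution_mul_cos hτ u hs m]
      refine integral_congr_ae ?_
      filter_upwards [hz s hs] with x hx
      rw [hx]
    have hbd : ∀ a b : ℂ, ∫ s in (0 : ℝ)..t, (u s 1 * a - u s 0 * b) =
        (∫ s in (0 : ℝ)..t, u s 1) * a - (∫ s in (0 : ℝ)..t, u s 0) * b := by
      intro a b
      rw [intervalIntegral.integral_sub ((hui 1 t ht).mul_const _) ((hui 0 t ht).mul_const _),
        intervalIntegral.integral_mul_const, intervalIntegral.integral_mul_const]
    rw [hbd, ← hcomm φ₂ hφ.memLp]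
    refine weak_equation_of_cos (z t).integrableOn
      (∫ s in (0 : ℝ)..t, z s : StateSpace).integrableOn (fun m => ?_) hφ
    have hcosm : MemLp (fun x : ℝ => -(m : ℂ) ^ 2 * Real.cos (m * x)) 2
        ((volume : Measure ℝ).restrict (Ioo 0 Real.pi)) := memLp_Ioo_of_continuous (by fun_prop)
    have hg : IntervalIntegrable (fun σ => Real.cos (m * Real.pi) * u σ 1 - u σ 0) volume 0 t :=
      ((hui 1 t ht).const_mul _).sub (hui 0 t ht)
    have hmul : ∀ s, ∫ x in Ioo 0 Real.pi, z s x * (-(m : ℂ) ^ 2 * Real.cos (m * x)) =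
        -(m : ℂ) ^ 2 * ∫ x in Ioo 0 Real.pi, z s x * Real.cos (m * x) := fun s => by
      rw [← integral_const_mul]; congr 1; ext x; ring
    rw [hcomm _ hcosm, hcoef m t ht, duhamel_eq ht.1 ((m : ℂ) ^ 2) hg]
    simp_rw [hmul]
    rw [intervalIntegral.integral_const_mul]
    congr 1
    · congr 1
      refine intervalIntegral.integral_congr fun s hs => ?_
      exact (hcoef m s (hsub hs)).symm
    · rw [intervalIntegral.integral_sub ((hui 1 t ht).const_mul _) (hui 0 t ht),
        intervalIntegral.integral_const_mul, mul_comm]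

/-! ## Exponentials form Bessel families -/

lemma integral_cexp_int_mul {ω R : ℝ} {N : ℕ} (hω : 0 < ω) (hR : R * ω = N * (2 * Real.pi))
    (k : ℤ) :
    ∫ t in (0 : ℝ)..R, Complex.exp (Complex.I * k * ω * t) = if k = 0 then (R : ℂ) else 0 := by
  split_ifs with hk
  · simp [hk]
  · have hc : Complex.I * k * ω ≠ 0 := by
      have : (k : ℂ) ≠ 0 := by exact_mod_cast hk
      have : (ω : ℂ) ≠ 0 := by exact_mod_cast hω.ne'
      simp [*]
    rw [integral_exp_mul_complex hc]
    have : Complex.I * k * ω * R = ((k * N : ℤ) : ℂ) * (2 * Real.pi * Complex.I) := by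
      have h : (R : ℂ) * ω = N * (2 * Real.pi) := by exact_mod_cast hR
      push_cast
      linear_combination (Complex.I * k) * h
    rw [this, Complex.exp_int_mul_two_pi_mul_I]
    simp

lemma norm_cexp_I_int_mul (n : ℤ) (ω t : ℝ) : ‖Complex.exp (Complex.I * n * ω * t)‖ = 1 := by
  have : Complex.I * n * ω * t = ((n * ω * t : ℝ) : ℂ) * Complex.I := by push_cast; ring
  rw [this, Complex.norm_exp_ofReal_mul_I]

/-- R is a whole number of periods 2π/ω, so the exponentials scaled by R^(-1/2) are orthonormal on
[0, R] and Bessel's inequality applies. -/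
lemma sum_sq_norm_integral_cexp_le {ω R : ℝ} {N : ℕ} (hω : 0 < ω) (hR0 : 0 < R)
    (hR : R * ω = N * (2 * Real.pi)) {g : ℝ → ℂ}
    (hg : MemLp g 2 ((volume : Measure ℝ).restrict (Icc 0 R))) (s : Finset ℤ) :
    ∑ n ∈ s, ‖∫ t in Icc 0 R, g t * star (Complex.exp (Complex.I * n * ω * t))‖ ^ 2 ≤
      R * ∫ t in Icc 0 R, ‖g t‖ ^ 2 := by
  set μ := (volume : Measure ℝ).restrict (Icc 0 R) with hμ
  set c : ℝ := (Real.sqrt R)⁻¹ with hc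
  have hcc : c * c = R⁻¹ := by
    rw [hc, ← mul_inv, Real.mul_self_sqrt hR0.le]
  have hm : ∀ n : ℤ, MemLp (fun t : ℝ => (c : ℂ) * Complex.exp (Complex.I * n * ω * t)) 2 μ := by
    intro n
    refine MemLp.of_bound (Continuous.aestronglyMeasurable (by fun_prop)) ‖c‖
      (Filter.Eventually.of_forall fun t => ?_)
    rw [norm_mul, norm_cexp_I_int_mul, mul_one, Complex.norm_real]
  have hinner : ∀ (n : ℤ) (G : ℝ → ℂ) (hG : MemLp G 2 μ),
      (inner ℂ ((hm n).toLp _) (hG.toLp G) : ℂ) =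
        c * ∫ t, G t * star (Complex.exp (Complex.I * n * ω * t)) ∂μ := by
    intro n G hG
    rw [L2.inner_def, ← integral_const_mul]
    refine integral_congr_ae ?_
    filter_upwards [(hm n).coeFn_toLp, hG.coeFn_toLp] with t h1 h2
    rw [h1, h2]
    simp
    ring
  have hon : Orthonormal ℂ fun n : ℤ => (hm n).toLp _ := by
    rw [orthonormal_iff_ite]
    intro n m
    rw [hinner n _ (hm m)]
    have e : ∀ t : ℝ, (c : ℂ) * Complex.exp (Complex.I * m * ω * t) *
        star (Complex.exp (Complex.I * n * ω * t)) =
        c * Complex.exp (Complex.I * (m - n : ℤ) * ω * t) := by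
      intro t
      rw [mul_assoc, Complex.star_def, ← Complex.exp_conj, ← Complex.exp_add]
      congr 2
      simp only [map_mul, Complex.conj_I, Complex.conj_ofReal, map_intCast]
      push_cast; ring
    simp_rw [e]
    rw [integral_const_mul, hμ, integral_Icc_eq_integral_Ioc,
      ← intervalIntegral.integral_of_le hR0.le, integral_cexp_int_mul hω hR]
    have hR' : (R : ℂ) ≠ 0 := by exact_mod_cast hR0.ne'
    by_cases h : n = m
    · rw [if_pos (sub_eq_zero.2 h.symm), if_pos h, ← mul_assoc, ← Complex.ofReal_mul, hcc]
      push_cast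
      exact inv_mul_cancel₀ hR'
    · rw [if_neg (fun h' => h (sub_eq_zero.1 h').symm), if_neg h]
      simp
  have hb := hon.sum_inner_products_le (hg.toLp g) (s := s)
  simp_rw [hinner _ g hg, norm_mul, mul_pow] at hb
  rw [← Finset.mul_sum, hg.norm_toLp_sq, Complex.norm_real, Real.norm_eq_abs, sq_abs, pow_two,
    hcc, inv_mul_le_iff₀ hR0] at hb
  exact hb

lemma continuous_euclideanSpace_single (j : Fin 2) :
    Continuous fun c : ℂ => (EuclideanSpace.single j c : EuclideanSpace ℂ (Fin 2)) := by
  have : (fun c : ℂ => (EuclideanSpace.single j c : EuclideanSpace ℂ (Fin 2))) =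
      fun c => c • EuclideanSpace.single j (1 : ℂ) := by
    ext c i; simp
  rw [this]
  fun_prop

lemma memLp_exponential (τ ω : ℝ) (j : Fin 2) (n : ℤ) :
    MemLp (fun t : ℝ => EuclideanSpace.single j (Complex.exp (Complex.I * n * ω * t))) 2
      ((volume : Measure ℝ).restrict (Icc 0 τ)) := by
  refine MemLp.of_bound (C := 1) ?_ (Filter.Eventually.of_forall fun t => ?_)
  · exact ((continuous_euclideanSpace_single j).comp (by fun_prop)).aestronglyMeasurable
  · rw [PiLp.norm_single, norm_cexp_I_int_mul]

lemma memLp_weighted_exponential {τ γ : ℝ} (hτ : 0 < τ) (hγ : γ < 1 / 2) (ω : ℝ) (j : Fin 2)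
    (n : ℤ) :
    MemLp (fun t : ℝ => EuclideanSpace.single j
        ((((τ - t) ^ (-γ) : ℝ) : ℂ) * Complex.exp (Complex.I * n * ω * t))) 2
      ((volume : Measure ℝ).restrict (Icc 0 τ)) := by
  refine (memLp_two_sub_rpow (r := -γ) hτ (by linarith)).of_le ?_
    (Filter.Eventually.of_forall fun t => ?_)
  · have h : Measurable fun t : ℝ => (((τ - t) ^ (-γ) : ℝ) : ℂ) *
      Complex.exp (Complex.I * n * ω * t) := by fun_prop
    exact ((continuous_euclideanSpace_single j).measurable.comp h).aestronglyMeasurable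
  · rw [PiLp.norm_single, norm_mul, norm_cexp_I_int_mul, mul_one, Complex.norm_real]

/-- τ need not be a multiple of the period 2π/ω. Extending by zero to [0, R], with R ≥ τ such a
multiple, gives the Bessel bound R. -/
lemma exists_isBesselFamily_exponential {τ ω : ℝ} (hτ : 0 < τ) (hω : 0 < ω) (j : Fin 2) :
    ∃ M : ℝ, 0 ≤ M ∧ IsBesselFamily (fun n : ℤ => (memLp_exponential τ ω j n).toLp _) M := by
  obtain ⟨N, hN⟩ := exists_nat_gt (τ * ω / (2 * Real.pi))
  have hpi := Real.pi_pos
  set R : ℝ := N * (2 * Real.pi) / ω with hRdef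
  have hR : R * ω = N * (2 * Real.pi) := by rw [hRdef]; field_simp
  have hτR : τ ≤ R := by
    rw [hRdef, le_div_iff₀ hω]
    rw [div_lt_iff₀ (by positivity)] at hN
    exact hN.le
  have hR0 : 0 < R := hτ.trans_le hτR
  refine ⟨R, hR0.le, fun s x => ?_⟩
  set g : ℝ → ℂ := (Icc 0 τ).indicator fun t => x t j with hg
  have hinter : Icc 0 τ ∩ Icc 0 R = Icc 0 τ := inter_eq_left.2 (Icc_subset_Icc_right hτR)
  have hxj : MemLp (fun t => x t j) 2 ((volume : Measure ℝ).restrict (Icc 0 τ)) :=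
    (Lp.memLp x).of_le ((PiLp.continuous_apply 2 _ j).comp_aestronglyMeasurable (Lp.memLp x).1)
      (Filter.Eventually.of_forall fun t => PiLp.norm_apply_le (x t) j)
  have hgm : MemLp g 2 ((volume : Measure ℝ).restrict (Icc 0 R)) := by
    rw [hg, memLp_indicator_iff_restrict measurableSet_Icc,
      Measure.restrict_restrict measurableSet_Icc, hinter]
    exact hxj
  have h1 : ∀ n : ℤ, (inner ℂ ((memLp_exponential τ ω j n).toLp _) x : ℂ) =
      ∫ t in Icc 0 R, g t * star (Complex.exp (Complex.I * n * ω * t)) := by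
    intro n
    have e : ∀ t, g t * star (Complex.exp (Complex.I * n * ω * t)) = (Icc 0 τ).indicator
        (fun t => x t j * star (Complex.exp (Complex.I * n * ω * t))) t := by
      intro t
      by_cases ht : t ∈ Icc 0 τ
      · rw [hg, indicator_of_mem ht, indicator_of_mem ht]
      · rw [hg, indicator_of_notMem ht, indicator_of_notMem ht, zero_mul]
    simp_rw [e]
    rw [integral_indicator measurableSet_Icc, Measure.restrict_restrict measurableSet_Icc, hinter,
      L2.inner_def]
    refine integral_congr_ae ?_
    filter_upwards [(memLp_exponential τ ω j n).coeFn_toLp] with t ht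
    rw [ht, EuclideanSpace.inner_single_left, mul_comm]
    rfl
  have h2 : ∫ t in Icc 0 R, ‖g t‖ ^ 2 ≤ ‖x‖ ^ 2 := by
    have e : ∀ t, ‖g t‖ ^ 2 = (Icc 0 τ).indicator (fun t => ‖x t j‖ ^ 2) t := by
      intro t
      by_cases ht : t ∈ Icc 0 τ
      · rw [hg, indicator_of_mem ht, indicator_of_mem ht]
      · rw [hg, indicator_of_notMem ht, indicator_of_notMem ht]; simp
    have hx := (Lp.memLp x).norm_toLp_sq
    rw [Lp.toLp_coeFn] at hx
    simp_rw [e]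
    rw [integral_indicator measurableSet_Icc, Measure.restrict_restrict measurableSet_Icc, hinter,
      hx]
    refine integral_mono hxj.norm.integrable_sq (Lp.memLp x).norm.integrable_sq fun t => ?_
    exact pow_le_pow_left₀ (norm_nonneg _) (PiLp.norm_apply_le (x t) j) 2
  simp_rw [h1]
  refine (sum_sq_norm_integral_cexp_le hω hR0 hR hgm s).trans ?_
  gcongr

end

theorem proposition7p6 (τ δ Θ : ℝ) (hτ : 0 < τ) (hδ : δ ∈ Set.Ioo (0 : ℝ) 1)
    (hΘ : Θ ∈ Set.Ioo (0 : ℝ) (Real.pi / 4)) :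
    -- the input map, as an operator into the Bergman–Sobolev space
    ∃ Φ : InputSpace τ →L[ℂ] BergmanSobolev δ Θ,
      (∀ u : InputSpace τ, ∃ z : ℝ → StateSpace,
        IsNeumannSolution τ u z ∧
        (∀ z' : ℝ → StateSpace, IsNeumannSolution τ u z' → Set.EqOn z' z (Set.Icc 0 τ)) ∧
        HasTrace (Φ u) (z τ)) ∧
      IsHilbertSchmidt Φ ∧
      ∀ γ ∈ Set.Ico (0 : ℝ) (δ / 4),
        -- the weighted exponentials, placed in either of the two components
        (∀ ω : ℝ, 0 < ω → ∀ j : Fin 2, ∃ e : ℤ → InputSpace τ,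
          (∀ n : ℤ, ∀ᵐ t : ℝ ∂(MeasureTheory.volume.restrict (Set.Icc 0 τ)),
            e n t = EuclideanSpace.single j
              ((((τ - t) ^ (-γ) : ℝ) : ℂ) * Complex.exp (Complex.I * n * ω * t))) ∧
          Summable fun n : ℤ => ‖Φ (e n)‖ ^ 2) ∧
        -- the weighted input map
        ∃ L : InputSpace τ →L[ℂ] BergmanSobolev δ Θ,
          IsHilbertSchmidt L ∧
          ∀ u v : InputSpace τ,
            (∀ᵐ t : ℝ ∂(MeasureTheory.volume.restrict (Set.Icc 0 τ)),
              v t = (((τ - t) ^ (-γ) : ℝ) : ℂ) • u t) →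
            L u = Φ v := by
  obtain ⟨hδ0, hδ1⟩ := hδ
  obtain ⟨hΘ0, hΘ1⟩ := hΘ
  have htan0 : 0 ≤ Real.tan Θ := (Real.tan_pos_of_pos_of_lt_pi_div_two hΘ0 (by linarith)).le
  have htan1 : Real.tan Θ < 1 := by
    rw [← Real.tan_pi_div_four]
    exact Real.tan_lt_tan_of_nonneg_of_lt_pi_div_two hΘ0.le (by linarith) hΘ1
  -- The input map itself is the weighted one with trivial weight.
  obtain ⟨Φ, hΦ1, hΦ2⟩ := exists_weightedInputMap (γ := 0) hτ hδ0 htan0 htan1 le_rfl (by linarith)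
  have hHS : ∀ T : InputSpace τ →L[ℂ] BergmanSobolev δ Θ,
      (∀ (ι : Type) (b : ι → InputSpace τ) (M : ℝ), 0 ≤ M → IsBesselFamily b M →
        Summable fun i => ‖T (b i)‖ ^ 2) → IsHilbertSchmidt T :=
    fun T hT s b => hT s b 1 zero_le_one b.isBesselFamily
  refine ⟨Φ, fun u => ?_, hHS Φ hΦ2, fun γ hγ => ?_⟩
  · obtain ⟨z, hz, hzval⟩ := exists_isNeumannSolution hτ u
    refine ⟨z, hz, fun z' hz' => hz.eqOn hz', _, hΦ1 u, ?_⟩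
    filter_upwards [hzval τ ⟨hτ.le, le_rfl⟩] with x hx
    rw [hx, mildSolution]
    simp only [weightedKernel, neg_zero, Real.rpow_zero, one_smul]
  · obtain ⟨hγ0, hγ1⟩ := hγ
    obtain ⟨L, hL1, hL2⟩ := exists_weightedInputMap hτ hδ0 htan0 htan1 hγ0 hγ1
    have hLΦ : ∀ u v : InputSpace τ,
        (∀ᵐ t : ℝ ∂(MeasureTheory.volume.restrict (Set.Icc 0 τ)),
          v t = (((τ - t) ^ (-γ) : ℝ) : ℂ) • u t) → L u = Φ v := by
      intro u v huv
      -- Both outputs are given by the same integral: the scalar weight moves from the kernel to the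
      -- input.
      refine (hL1 u).ext (hΦ1 v) (funext fun s => integral_congr_ae ?_)
      filter_upwards [huv] with t ht
      rw [ht, dotPair_smul_right, weightedKernel, weightedKernel, dotPair_smul_left,
        dotPair_smul_left, neg_zero, Real.rpow_zero, Complex.ofReal_one, one_mul]
    refine ⟨fun ω hω j => ?_, L, hHS L hL2, hLΦ⟩
    have hv := memLp_weighted_exponential hτ (γ := γ) (by linarith) ω j
    refine ⟨fun n => (hv n).toLp _, fun n => (hv n).coeFn_toLp, ?_⟩
    obtain ⟨M, hM0, hM⟩ := exists_isBesselFamily_exponential hτ hω j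
    -- Φ applied to a weighted exponential is L applied to the plain one, and the plain exponentials
    -- form a Bessel family.
    refine (hL2 ℤ _ M hM0 hM).congr fun n => ?_
    rw [hLΦ _ ((hv n).toLp _)]
    filter_upwards [(hv n).coeFn_toLp, (memLp_exponential τ ω j n).coeFn_toLp] with t h1 h2
    rw [h1, h2]
    ext i
    by_cases hi : i = j <;> simp [hi]
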